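/- Let $(X,\Sigma)$ be a measurable space and let $p(x,E)$ ($x\in X$, $E\in\Sigma$) be the transition function of a Markov chain: $p(x,\cdot)$ is a countably additive probability measure on $\Sigma$ for every $x\in X$, and $p(\cdot,E)$ is $\Sigma$-measurable for every $E\in\Sigma$. Let $ba(X,\Sigma)$ be the space of bounded finitely additive real measures (set functions) on $\Sigma$, and $ca(X,\Sigma)\subset ba(X,\Sigma)$ the Banach space of countably additive ones with the total variation norm. The Markov operator $A$ acts on $ba(X,\Sigma)$ by $$(A\mu)(E)=\int_X p(x,E)\,\mu(dx),\qquad E\in\Sigma,$$ and maps $ca(X,\Sigma)$ into itself. Let $S_{ba}=\{\mu\in ba(X,\Sigma):\mu\ge 0,\ \mu(X)=1\}$ and let $\Delta_{ba}=\{\mu\in S_{ba}: A\mu=\mu\}$. A measure $\mu\in ba(X,\Sigma)$ with $\mu\ge0$ is called purely finitely additive if every $\lambda\in ca(X,\Sigma)$ with $0\le\lambda\le\mu$ is zero; let $\Delta_{pfa}$ be the set of purely finitely additive measures in $\Delta_{ba}$. Consider the conditions $(*)$: $\Delta_{ba}\subset ca(X,\Sigma)$, i.e. every invariant finitely additive probability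 measure is countably additive; $(K)$ (quasicompactness): there are a compact linear operator $A_1: ca(X,\Sigma)\to ca(X,\Sigma)$ and an integer $k\ge1$ such that $\|A^k-A_1\|<1$ in the operator norm of $ca(X,\Sigma)$. Then: 1. if $(*)$ holds, then $(K)$ holds, i.e. the chain is quasicompact; 2. if the chain is not quasicompact, then $\Delta_{pfa}\neq\varnothing$, i.e. the chain has an invariant purely finitely additive probability measure. -/

import Mathlib

open MeasureTheory ProbabilityTheory Set Filter Topology

noncomputable section

namespace FAMarkov

variable {X : Type*} [MeasurableSpace X]

/-! ### Bounded finitely additive measures: the space `ba(X, Σ)` -/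

/-- A bounded finitely additive real set function on the measurable sets of `X`. As for Mathlib's
`VectorMeasure`, the value on a non-measurable set is fixed to be `0`, so that two charges are equal
as soon as they agree on the measurable sets. -/
structure Charge (X : Type*) [MeasurableSpace X] where
  toFun : Set X → ℝ
  not_measurable' : ∀ E, ¬ MeasurableSet E → toFun E = 0
  empty' : toFun ∅ = 0
  union' : ∀ E F, MeasurableSet E → MeasurableSet F → Disjoint E F →
    toFun (E ∪ F) = toFun E + toFun F
  bounded' : ∃ C, ∀ E, MeasurableSet E → |toFun E| ≤ C

namespace Charge

instance : CoeFun (Charge X) (fun _ => Set X → ℝ) := ⟨Charge.toFun⟩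

theorem ext {μ ν : Charge X} (h : ∀ E, MeasurableSet E → μ E = ν E) : μ = ν := by
  have : μ.toFun = ν.toFun := by
    funext E
    by_cases hE : MeasurableSet E
    · exact h E hE
    · rw [μ.not_measurable' E hE, ν.not_measurable' E hE]
  cases μ; cases ν; cases this; rfl

/-- `0 ≤ μ`. -/
def IsNonneg (μ : Charge X) : Prop := ∀ E, MeasurableSet E → 0 ≤ μ E

/-- `μ ∈ ca(X, Σ)`. -/
def IsCountablyAdditive (μ : Charge X) : Prop :=
  ∀ E : ℕ → Set X, (∀ n, MeasurableSet (E n)) → Pairwise (Function.onFun Disjoint E) →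
    HasSum (fun n => μ (E n)) (μ (⋃ n, E n))

/-- A nonnegative charge `μ` is purely finitely additive if every countably additive measure `lam`
with `0 ≤ lam ≤ μ` vanishes identically. -/
def IsPurelyFinitelyAdditive (μ : Charge X) : Prop :=
  μ.IsNonneg ∧ ∀ lam : Charge X, lam.IsCountablyAdditive → lam.IsNonneg →
    (∀ E, MeasurableSet E → lam E ≤ μ E) → ∀ E, MeasurableSet E → lam E = 0

/-- `μ ∈ S_ba`: a nonnegative charge with total mass (equivalently, norm) one. -/
def IsProbability (μ : Charge X) : Prop := μ.IsNonneg ∧ μ univ = 1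

/-! ### The integral of a bounded measurable function against a charge -/

/-- The integral of a simple function. -/
def simpleIntegral (μ : Charge X) (g : SimpleFunc X ℝ) : ℝ :=
  ∑ y ∈ g.range, y * μ (g ⁻¹' {y})

/-- `I` is the integral of `f` against `μ`: it is the limit of the integrals of simple functions
converging uniformly to `f`. -/
def HasIntegral (μ : Charge X) (f : X → ℝ) (I : ℝ) : Prop :=
  ∃ g : ℕ → SimpleFunc X ℝ, TendstoUniformly (fun n x => g n x) f atTop ∧
    Tendsto (fun n => μ.simpleIntegral (g n)) atTop (𝓝 I)

open Classical in
/-- The integral `∫ f dμ` (used for bounded measurable `f`, for which it exists and is unique, see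
`hasIntegral_integral` and `HasIntegral.unique`). -/
def integral (μ : Charge X) (f : X → ℝ) : ℝ :=
  if h : ∃ I, μ.HasIntegral f I then h.choose else 0

/-- Multiplication by the number `μ s`, regarded as an operator on `ℝ`. -/
def opFun (μ : Charge X) (s : Set X) : ℝ →L[ℝ] ℝ := μ s • ContinuousLinearMap.id ℝ ℝ

theorem opFun_add (μ : Charge X) : FinMeasAdditive (0 : Measure X) μ.opFun := by
  intro s t hs ht _ _ hd
  simp only [opFun, μ.union' s t hs ht hd, add_smul]

theorem simpleIntegral_eq (μ : Charge X) (g : SimpleFunc X ℝ) :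
    μ.simpleIntegral g = g.setToSimpleFunc μ.opFun := by
  simp only [simpleIntegral, SimpleFunc.setToSimpleFunc, opFun]
  refine Finset.sum_congr rfl fun y _ => ?_
  simp [mul_comm]

theorem simpleIntegral_add (μ : Charge X) (g h : SimpleFunc X ℝ) :
    μ.simpleIntegral (g + h) = μ.simpleIntegral g + μ.simpleIntegral h := by
  simp only [simpleIntegral_eq]
  exact SimpleFunc.setToSimpleFunc_add _ μ.opFun_add (integrable_zero_measure)
    (integrable_zero_measure)

theorem simpleIntegral_sub (μ : Charge X) (g h : SimpleFunc X ℝ) :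
    μ.simpleIntegral (g - h) = μ.simpleIntegral g - μ.simpleIntegral h := by
  simp only [simpleIntegral_eq]
  exact SimpleFunc.setToSimpleFunc_sub _ μ.opFun_add (integrable_zero_measure)
    (integrable_zero_measure)

theorem biUnion_finset (μ : Charge X) {ι : Type*} (s : Finset ι) (E : ι → Set X)
    (hE : ∀ i, MeasurableSet (E i)) (hd : Pairwise (Function.onFun Disjoint E)) :
    μ (⋃ i ∈ s, E i) = ∑ i ∈ s, μ (E i) := by
  classical
  induction s using Finset.induction_on with
  | empty => simp [μ.empty']
  | insert a s ha ih =>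
    rw [Finset.set_biUnion_insert, Finset.sum_insert ha, ← ih]
    refine μ.union' _ _ (hE a) (s.measurableSet_biUnion fun i _ => hE i) ?_
    rw [disjoint_iUnion₂_right]
    intro i hi
    exact hd (fun h => ha (h ▸ hi))

/-- A constant bounding the integral of simple functions by their supremum norm. -/
theorem exists_bound (μ : Charge X) : ∃ C, 0 ≤ C ∧ ∀ (g : SimpleFunc X ℝ) (c : ℝ), 0 ≤ c →
    (∀ x, |g x| ≤ c) → |μ.simpleIntegral g| ≤ C * c := by
  classical
  obtain ⟨C, hC⟩ := μ.bounded'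
  have hC0 : 0 ≤ C := (abs_nonneg _).trans (hC ∅ MeasurableSet.empty)
  refine ⟨2 * C, by positivity, fun g c hc hg => ?_⟩
  have key : ∑ y ∈ g.range, |μ (g ⁻¹' {y})| ≤ 2 * C := by
    have hm : ∀ y : ℝ, MeasurableSet (g ⁻¹' {y}) := fun y => g.measurableSet_fiber y
    have hd : Pairwise (Function.onFun Disjoint fun y : ℝ => g ⁻¹' {y}) := by
      intro a b hab
      exact Disjoint.preimage _ (by simpa using hab)
    have hb : ∀ s : Finset ℝ, |∑ y ∈ s, μ (g ⁻¹' {y})| ≤ C := by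
      intro s
      rw [← μ.biUnion_finset s _ hm hd]
      exact hC _ (s.measurableSet_biUnion fun i _ => hm i)
    rw [← Finset.sum_filter_add_sum_filter_not g.range (fun y => 0 ≤ μ (g ⁻¹' {y}))]
    have h1 : ∑ y ∈ g.range with 0 ≤ μ (g ⁻¹' {y}), |μ (g ⁻¹' {y})| ≤ C := by
      rw [Finset.sum_congr rfl (fun y hy => abs_of_nonneg (Finset.mem_filter.1 hy).2)]
      exact (le_abs_self _).trans (hb _)
    have h2 : ∑ y ∈ g.range with ¬ 0 ≤ μ (g ⁻¹' {y}), |μ (g ⁻¹' {y})| ≤ C := by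
      rw [Finset.sum_congr rfl
        (fun y hy => abs_of_neg (not_le.1 (Finset.mem_filter.1 hy).2)), Finset.sum_neg_distrib]
      exact (neg_le_abs _).trans (hb _)
    linarith
  calc |μ.simpleIntegral g| ≤ ∑ y ∈ g.range, |y * μ (g ⁻¹' {y})| := Finset.abs_sum_le_sum_abs _ _
    _ ≤ ∑ y ∈ g.range, c * |μ (g ⁻¹' {y})| := by
        refine Finset.sum_le_sum fun y hy => ?_
        obtain ⟨x, rfl⟩ := SimpleFunc.mem_range.1 hy
        rw [abs_mul]
        exact mul_le_mul_of_nonneg_right (hg x) (abs_nonneg _)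
    _ = c * ∑ y ∈ g.range, |μ (g ⁻¹' {y})| := by rw [Finset.mul_sum]
    _ ≤ 2 * C * c := by nlinarith

/-- The integral does not depend on the approximating sequence. -/
theorem HasIntegral.unique {μ : Charge X} {f : X → ℝ} {I J : ℝ} (hI : μ.HasIntegral f I)
    (hJ : μ.HasIntegral f J) : I = J := by
  obtain ⟨C, hC0, hC⟩ := μ.exists_bound
  obtain ⟨g, hg, hgI⟩ := hI
  obtain ⟨h, hh, hhJ⟩ := hJ
  have hlim : Tendsto (fun n => μ.simpleIntegral (g n - h n)) atTop (𝓝 (I - J)) := by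
    simp only [simpleIntegral_sub]
    exact hgI.sub hhJ
  have hzero : Tendsto (fun n => μ.simpleIntegral (g n - h n)) atTop (𝓝 0) := by
    rw [Metric.tendsto_atTop]
    intro ε hε
    have hδ : 0 < ε / (2 * (C + 1)) := by positivity
    rw [Metric.tendstoUniformly_iff] at hg hh
    obtain ⟨N, hN⟩ := eventually_atTop.1 ((hg _ hδ).and (hh _ hδ))
    refine ⟨N, fun n hn => ?_⟩
    have hb : ∀ x, |(g n - h n) x| ≤ 2 * (ε / (2 * (C + 1))) := by
      intro x
      have h1 := (hN n hn).1 x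
      have h2 := (hN n hn).2 x
      rw [Real.dist_eq] at h1 h2
      rw [SimpleFunc.sub_apply, abs_le]
      rw [abs_lt] at h1 h2
      constructor <;> linarith
    have := hC (g n - h n) _ (by positivity) hb
    rw [Real.dist_eq, sub_zero]
    refine this.trans_lt ?_
    have e : C * (2 * (ε / (2 * (C + 1)))) = ε * (C / (C + 1)) := by field_simp
    rw [e]
    have : C / (C + 1) < 1 := by rw [div_lt_one (by positivity)]; linarith
    nlinarith
  linarith [tendsto_nhds_unique hlim hzero]

/-- Every bounded measurable function has an integral. -/
theorem exists_hasIntegral (μ : Charge X) {f : X → ℝ} (hf : Measurable f)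
    (hb : ∃ M, ∀ x, |f x| ≤ M) : ∃ I, μ.HasIntegral f I := by
  obtain ⟨M, hM⟩ := hb
  have hfin : ∀ n : ℕ, (Set.range fun x => (⌊((n : ℝ) + 1) * f x⌋ : ℝ) / ((n : ℝ) + 1)).Finite := by
    intro n
    have hn : (0 : ℝ) < (n : ℝ) + 1 := by positivity
    refine ((Set.finite_Icc (-⌈((n : ℝ) + 1) * M⌉) ⌈((n : ℝ) + 1) * M⌉).image
      (fun k : ℤ => (k : ℝ) / ((n : ℝ) + 1))).subset ?_
    rintro _ ⟨x, rfl⟩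
    have hx := abs_le.1 (hM x)
    refine ⟨⌊((n : ℝ) + 1) * f x⌋, ⟨?_, ?_⟩, rfl⟩
    · rw [Int.le_floor]
      push_cast
      have := Int.le_ceil (((n : ℝ) + 1) * M)
      nlinarith
    · have h1 := Int.floor_le (((n : ℝ) + 1) * f x)
      have h2 := Int.le_ceil (((n : ℝ) + 1) * M)
      have h3 : ((⌊((n : ℝ) + 1) * f x⌋ : ℤ) : ℝ) ≤ (⌈((n : ℝ) + 1) * M⌉ : ℤ) := by nlinarith
      exact_mod_cast h3
  have hmeas : ∀ n : ℕ, Measurable fun x => (⌊((n : ℝ) + 1) * f x⌋ : ℝ) / ((n : ℝ) + 1) := by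
    intro n
    have h1 : Measurable fun x => ⌊((n : ℝ) + 1) * f x⌋ := (hf.const_mul _).floor
    have h2 : Measurable fun k : ℤ => (k : ℝ) := measurable_from_top
    exact (h2.comp h1).div_const _
  let g : ℕ → SimpleFunc X ℝ := fun n =>
    ⟨fun x => (⌊((n : ℝ) + 1) * f x⌋ : ℝ) / ((n : ℝ) + 1),
      fun y => hmeas n (measurableSet_singleton y), hfin n⟩
  have hg : ∀ n x, |f x - g n x| ≤ 1 / ((n : ℝ) + 1) := by
    intro n x
    change |f x - (⌊((n : ℝ) + 1) * f x⌋ : ℝ) / ((n : ℝ) + 1)| ≤ _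
    have hn : (0 : ℝ) < (n : ℝ) + 1 := by positivity
    have h1 := Int.floor_le (((n : ℝ) + 1) * f x)
    have h2 := Int.lt_floor_add_one (((n : ℝ) + 1) * f x)
    have e : f x - (⌊((n : ℝ) + 1) * f x⌋ : ℝ) / ((n : ℝ) + 1)
        = (((n : ℝ) + 1) * f x - ⌊((n : ℝ) + 1) * f x⌋) / ((n : ℝ) + 1) := by field_simp
    rw [e, abs_of_nonneg (div_nonneg (by linarith) hn.le)]
    gcongr
    linarith
  have hunif : TendstoUniformly (fun n x => g n x) f atTop := by
    rw [Metric.tendstoUniformly_iff]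
    intro ε hε
    obtain ⟨N, hN⟩ := exists_nat_one_div_lt hε
    filter_upwards [eventually_ge_atTop N] with n hn x
    rw [Real.dist_eq]
    exact ((hg n x).trans (one_div_le_one_div_of_le (by positivity) (by gcongr))).trans_lt hN
  obtain ⟨C, hC0, hC⟩ := μ.exists_bound
  have hcauchy : CauchySeq fun n => μ.simpleIntegral (g n) := by
    refine cauchySeq_of_le_tendsto_0 (fun N : ℕ => C * (2 * (1 / ((N : ℝ) + 1)))) ?_ ?_
    · intro n m N hn hm
      rw [Real.dist_eq, ← simpleIntegral_sub]
      refine hC _ _ (by positivity) fun x => ?_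
      have h1 := (hg n x).trans (one_div_le_one_div_of_le (by positivity)
        (show (N : ℝ) + 1 ≤ (n : ℝ) + 1 by gcongr))
      have h2 := (hg m x).trans (one_div_le_one_div_of_le (by positivity)
        (show (N : ℝ) + 1 ≤ (m : ℝ) + 1 by gcongr))
      rw [abs_le] at h1 h2
      rw [SimpleFunc.sub_apply, abs_le]
      constructor <;> linarith
    · have := (tendsto_one_div_add_atTop_nhds_zero_nat (𝕜 := ℝ)).const_mul 2 |>.const_mul C
      simpa using this
  obtain ⟨I, hI⟩ := cauchySeq_tendsto_of_complete hcauchy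
  exact ⟨I, g, hunif, hI⟩

theorem hasIntegral_integral (μ : Charge X) {f : X → ℝ} (hf : Measurable f)
    (hb : ∃ M, ∀ x, |f x| ≤ M) : μ.HasIntegral f (μ.integral f) := by
  have h := μ.exists_hasIntegral hf hb
  rw [integral, dif_pos h]
  exact h.choose_spec

theorem HasIntegral.integral_eq {μ : Charge X} {f : X → ℝ} {I : ℝ} (h : μ.HasIntegral f I) :
    μ.integral f = I := by
  have h' : ∃ I, μ.HasIntegral f I := ⟨I, h⟩
  rw [integral, dif_pos h']
  exact h'.choose_spec.unique h

theorem HasIntegral.add {μ : Charge X} {f f' : X → ℝ} {I I' : ℝ} (h : μ.HasIntegral f I)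
    (h' : μ.HasIntegral f' I') : μ.HasIntegral (f + f') (I + I') := by
  obtain ⟨g, hg, hgI⟩ := h
  obtain ⟨g', hg', hgI'⟩ := h'
  refine ⟨fun n => g n + g' n, ?_, ?_⟩
  · exact hg.add hg'
  · simp only [simpleIntegral_add]
    exact hgI.add hgI'

theorem hasIntegral_zero (μ : Charge X) : μ.HasIntegral (fun _ => 0) 0 := by
  refine ⟨fun _ => 0, ?_, ?_⟩
  · rw [Metric.tendstoUniformly_iff]
    intro ε hε
    simp [hε]
  · have : μ.simpleIntegral (0 : SimpleFunc X ℝ) = 0 := by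
      have := μ.simpleIntegral_sub 0 0
      simpa using this
    simp [this]

theorem HasIntegral.abs_le {μ : Charge X} : ∃ C, ∀ (f : X → ℝ) (I : ℝ), μ.HasIntegral f I →
    (∀ x, |f x| ≤ 1) → |I| ≤ C := by
  obtain ⟨C, hC0, hC⟩ := μ.exists_bound
  refine ⟨C * 2, fun f I ⟨g, hg, hgI⟩ hf => ?_⟩
  rw [Metric.tendstoUniformly_iff] at hg
  refine le_of_tendsto hgI.abs ?_
  filter_upwards [hg 1 one_pos] with n hn
  refine hC _ _ (by norm_num) fun x => ?_
  have h1 := hn x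
  have h2 := hf x
  rw [Real.dist_eq, abs_lt] at h1
  rw [_root_.abs_le] at h2 ⊢
  constructor <;> linarith

end Charge

/-! ### The Markov operator on finitely additive measures -/

theorem measurable_kernel_real (κ : Kernel X X) {E : Set X} (hE : MeasurableSet E) :
    Measurable fun x => (κ x).real E :=
  (κ.measurable_coe hE).ennreal_toReal

theorem abs_kernel_real_le (κ : Kernel X X) [IsMarkovKernel κ] (E : Set X) (x : X) :
    |(κ x).real E| ≤ 1 := by
  rw [abs_of_nonneg measureReal_nonneg]
  exact measureReal_le_one

open Classical in
/-- The Markov operator `A : ba(X, Σ) → ba(X, Σ)`, `(A μ)(E) = ∫ p(x, E) μ(dx)`, where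
`p(x, E) = κ x E` is the transition function. -/
def chargeOperator (κ : Kernel X X) [IsMarkovKernel κ] (μ : Charge X) : Charge X where
  toFun E := if MeasurableSet E then μ.integral (fun x => (κ x).real E) else 0
  not_measurable' E hE := if_neg hE
  empty' := by
    simp only [MeasurableSet.empty, if_true, measureReal_empty]
    exact μ.hasIntegral_zero.integral_eq
  union' E F hE hF hd := by
    simp only [hE, hF, hE.union hF, if_true]
    have h1 := μ.hasIntegral_integral (measurable_kernel_real κ hE) ⟨1, abs_kernel_real_le κ E⟩
    have h2 := μ.hasIntegral_integral (measurable_kernel_real κ hF) ⟨1, abs_kernel_real_le κ F⟩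
    refine Charge.HasIntegral.integral_eq ?_
    have e : (fun x => (κ x).real (E ∪ F))
        = (fun x => (κ x).real E) + fun x => (κ x).real F := by
      funext x
      exact measureReal_union hd hF
    rw [e]
    exact h1.add h2
  bounded' := by
    obtain ⟨C, hC⟩ := Charge.HasIntegral.abs_le (μ := μ)
    refine ⟨C, fun E hE => ?_⟩
    simp only [hE, if_true]
    exact hC _ _ (μ.hasIntegral_integral (measurable_kernel_real κ hE)
      ⟨1, abs_kernel_real_le κ E⟩) (abs_kernel_real_le κ E)

/-- `Δ_ba`: the invariant finitely additive probability measures of the chain. -/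
def invariantCharges (κ : Kernel X X) [IsMarkovKernel κ] : Set (Charge X) :=
  {μ | μ.IsProbability ∧ chargeOperator κ μ = μ}

/-- `Δ_pfa`: the invariant purely finitely additive probability measures of the chain. -/
def invariantPureCharges (κ : Kernel X X) [IsMarkovKernel κ] : Set (Charge X) :=
  {μ | μ.IsPurelyFinitelyAdditive ∧ μ.IsProbability ∧ chargeOperator κ μ = μ}

/-- Condition `(*)`: `Δ_ba ⊆ ca(X, Σ)`. -/
def ConditionStar (κ : Kernel X X) [IsMarkovKernel κ] : Prop :=
  invariantCharges κ ⊆ {μ | μ.IsCountablyAdditive}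

/-! ### The space `ca(X, Σ)` of signed measures with the total variation norm -/

instance variation_finite (μ : SignedMeasure X) : IsFiniteMeasure μ.variation := by
  rw [← SignedMeasure.totalVariation_eq_variation]
  infer_instance

/-- `ca(X, Σ)` is normed by `‖μ‖ = |μ|(X)`, the total variation. -/
instance instNormedAddCommGroupCa : NormedAddCommGroup (SignedMeasure X) :=
  AddGroupNorm.toNormedAddCommGroup
    { toFun := fun μ => μ.variation.real univ
      map_zero' := by simp
      add_le' := fun μ ν => by
        rw [← measureReal_add_apply]
        exact ENNReal.toReal_mono (measure_ne_top _ _) (VectorMeasure.variation_add_le univ)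
      neg' := fun μ => by rw [VectorMeasure.variation_neg]
      eq_zero_of_map_eq_zero' := fun μ h => by
        rw [measureReal_eq_zero_iff, Measure.measure_univ_eq_zero] at h
        exact VectorMeasure.variation_eq_zero.1 h }

theorem norm_signedMeasure_eq (μ : SignedMeasure X) : ‖μ‖ = μ.variation.real univ := rfl

instance instNormedSpaceCa : NormedSpace ℝ (SignedMeasure X) where
  norm_smul_le c μ := by
    rw [norm_signedMeasure_eq, norm_signedMeasure_eq, VectorMeasure.variation_smul,
      measureReal_nnreal_smul_apply, coe_nnnorm]

open VectorMeasure in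
theorem kernel_integrable (κ : Kernel X X) [IsMarkovKernel κ] (μ : SignedMeasure X) {E : Set X}
    (hE : MeasurableSet E) : μ.Integrable (fun x => (κ x).real E) :=
  Integrable.of_bound (measurable_kernel_real κ hE).aestronglyMeasurable 1
    (Eventually.of_forall fun x => abs_kernel_real_le κ E x)

open Classical in
/-- The image of a signed measure under the Markov operator: `(A μ)(E) = ∫ p(x, E) μ(dx)`. -/
def signedImage (κ : Kernel X X) [IsMarkovKernel κ] (μ : SignedMeasure X) : SignedMeasure X where
  measureOf' E := if MeasurableSet E then
    VectorMeasure.integral μ (fun x => (κ x).real E) (ContinuousLinearMap.lsmul ℝ ℝ) else 0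
  empty' := by simp
  not_measurable' E hE := if_neg hE
  m_iUnion' E hE hd := by
    simp only [hE, MeasurableSet.iUnion hE, if_true]
    have hs : ∀ x, HasSum (fun n => (κ x).real (E n)) ((κ x).real (⋃ n, E n)) := fun x => by
      simpa [hE, MeasurableSet.iUnion hE] using
        ((κ x).toSignedMeasure).hasSum_of_disjoint_iUnion hE hd
    refine VectorMeasure.hasSum_integral_of_dominated_convergence
      (fun n x => (κ x).real (E n))
      (fun n => (measurable_kernel_real κ (hE n)).aestronglyMeasurable)
      (fun n => Eventually.of_forall fun x => by
        rw [Real.norm_eq_abs, abs_of_nonneg measureReal_nonneg])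
      (Eventually.of_forall fun x => (hs x).summable) ?_ (Eventually.of_forall hs)
    simp only [(hs _).tsum_eq]
    exact kernel_integrable κ μ (MeasurableSet.iUnion hE)

theorem signedImage_apply (κ : Kernel X X) [IsMarkovKernel κ] (μ : SignedMeasure X) {E : Set X}
    (hE : MeasurableSet E) : signedImage κ μ E =
      VectorMeasure.integral μ (fun x => (κ x).real E) (ContinuousLinearMap.lsmul ℝ ℝ) :=
  if_pos hE

theorem norm_signedImage_le (κ : Kernel X X) [IsMarkovKernel κ] (μ : SignedMeasure X) :
    ‖signedImage κ μ‖ ≤ ‖μ‖ := by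
  have h : (signedImage κ μ).variation ≤ μ.variation.bind κ := by
    refine VectorMeasure.variation_le_of_forall_enorm_le fun E hE => ?_
    rw [signedImage_apply κ μ hE, Measure.bind_apply hE κ.measurable.aemeasurable]
    refine (VectorMeasure.enorm_integral_le_lintegral_enorm_transpose).trans ?_
    rw [VectorMeasure.variation_transpose_lsmul]
    refine lintegral_mono fun x => ?_
    rw [Real.enorm_eq_ofReal measureReal_nonneg, ofReal_measureReal]
  have h2 : (μ.variation.bind κ) univ = μ.variation univ := by
    rw [Measure.bind_apply MeasurableSet.univ κ.measurable.aemeasurable]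
    simp
  rw [norm_signedMeasure_eq, norm_signedMeasure_eq]
  refine ENNReal.toReal_mono (measure_ne_top _ _) ?_
  rw [← h2]
  exact h univ

/-- The Markov operator `A : ca(X, Σ) → ca(X, Σ)` as a bounded linear operator. -/
def markovOperator (κ : Kernel X X) [IsMarkovKernel κ] :
    SignedMeasure X →L[ℝ] SignedMeasure X :=
  LinearMap.mkContinuous
    { toFun := signedImage κ
      map_add' := fun μ ν => by
        refine VectorMeasure.ext fun E hE => ?_
        rw [add_apply]
        simp only [signedImage_apply κ _ hE]
        exact VectorMeasure.integral_add_vectorMeasure (kernel_integrable κ μ hE)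
          (kernel_integrable κ ν hE)
      map_smul' := fun c μ => by
        refine VectorMeasure.ext fun E hE => ?_
        rw [RingHom.id_apply, smul_apply]
        simp only [signedImage_apply κ _ hE]
        exact VectorMeasure.integral_smul_vectorMeasure _ c }
    1 (fun μ => by simpa using norm_signedImage_le κ μ)

/-- Condition `(K)`: the chain is quasicompact, i.e. `‖A ^ k - A₁‖ < 1` for some `k ≥ 1` and some
compact operator `A₁` on `ca(X, Σ)`. -/
def IsQuasicompact (κ : Kernel X X) [IsMarkovKernel κ] : Prop :=
  ∃ A₁ : SignedMeasure X →L[ℝ] SignedMeasure X, IsCompactOperator A₁ ∧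
    ∃ k : ℕ, 1 ≤ k ∧ ‖markovOperator κ ^ k - A₁‖ < 1

end FAMarkov

end

namespace FAMarkov

open scoped ENNReal

variable {X : Type*} [MeasurableSpace X]

/-! ### Integration against charges -/

namespace Charge

/-! Invariant charges arise as ultralimits of Cesàro averages of transition probabilities. If no
finite measure controlled these averages in Doeblin's sense, a gliding hump would produce averages
that keep mass `ε` on sets decreasing to `∅`; their ultralimit would be an invariant charge that is
not countably additive. So `ConditionStar` forces Doeblin control of the averages
(`ConditionStar.exists_cesaro_le`), and Chapman–Kolmogorov transfers it to a single power
(`ConditionStar.exists_pow_le`).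

Doeblin control, available for every `ε`, is then used twice. If a power `K` is controlled by `ψ`,
then for every finite `φ` the measure `φ ⊗ₘ K` is absolutely continuous with respect to `φ.prod ψ`
up to a small mass, and an integrable density is nearly of finite rank. Hence functions `w` bounded
by one, with zero `ψ`-integral over finitely many sets, have `K w` small in `L¹(φ)`. Another power,
controlled by `φ`, upgrades this to uniform smallness
(`ConditionStar.exists_finset_abs_integral_le`). Dually, `A ^ k` is within `1 / 2` of its
composition with the conditional expectation onto a finite partition, which has finite rank; this is
quasicompactness.

If the chain is not quasicompact, some invariant charge `μ` is therefore not countably additive. Let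
`ν` be the largest measure below `μ` (Yosida–Hewitt). By positivity of the operator, `ν.bind κ` is a
measure below `μ`, hence below `ν`, and equality of masses makes `ν` invariant. The remainder `μ -
ν` is invariant, nonzero and purely finitely additive; normalising it ends the proof. -/

theorem HasIntegral.exists_abs_sub_le (μ : Charge X) : ∃ C, 0 ≤ C ∧
    ∀ (f : X → ℝ) (I : ℝ) (g : SimpleFunc X ℝ) (c : ℝ), μ.HasIntegral f I →
      0 ≤ c → (∀ x, |f x - g x| ≤ c) → |I - μ.simpleIntegral g| ≤ C * c := by
  obtain ⟨C, hC0, hC⟩ := μ.exists_bound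
  refine ⟨C, hC0, fun f I g c ⟨h, hh, hI⟩ hc hfg => ?_⟩
  have hlim : Tendsto (fun n => μ.simpleIntegral (h n - g)) atTop
      (𝓝 (I - μ.simpleIntegral g)) := by
    simp only [simpleIntegral_sub]
    exact hI.sub_const _
  rw [Metric.tendstoUniformly_iff] at hh
  refine le_of_forall_pos_le_add fun ε hε => ?_
  have hδ : 0 < ε / (C + 1) := by positivity
  refine le_of_tendsto hlim.abs ?_
  filter_upwards [hh _ hδ] with n hn
  refine (hC (h n - g) (c + ε / (C + 1)) (by positivity) fun x => ?_).trans ?_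
  · have h1 := hn x
    have h2 := hfg x
    rw [Real.dist_eq, abs_lt] at h1
    rw [_root_.abs_le] at h2
    rw [SimpleFunc.sub_apply, _root_.abs_le]
    constructor <;> linarith
  · have : C * (ε / (C + 1)) ≤ ε := by
      rw [← mul_div_assoc, div_le_iff₀ (by positivity)]
      nlinarith
    linarith [mul_add C c (ε / (C + 1))]

/-- The freedom to choose the approximating sequence allows one sequence to serve two charges at
once, or to be truncated. -/
theorem HasIntegral.tendsto {μ : Charge X} {f : X → ℝ} {I : ℝ} (hI : μ.HasIntegral f I)
    {g : ℕ → SimpleFunc X ℝ} (hg : TendstoUniformly (fun n x => g n x) f atTop) :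
    Tendsto (fun n => μ.simpleIntegral (g n)) atTop (𝓝 I) := by
  obtain ⟨C, hC0, hC⟩ := HasIntegral.exists_abs_sub_le μ
  rw [Metric.tendstoUniformly_iff] at hg
  rw [Metric.tendsto_atTop]
  intro ε hε
  have hδ : 0 < ε / (C + 1) := by positivity
  obtain ⟨N, hN⟩ := eventually_atTop.1 (hg _ hδ)
  refine ⟨N, fun n hn => ?_⟩
  have h1 := hC f I (g n) _ hI hδ.le fun x => (Real.dist_eq _ _ ▸ (hN n hn x)).le
  rw [dist_comm, Real.dist_eq]
  refine h1.trans_lt ?_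
  rw [← mul_div_assoc, div_lt_iff₀ (by positivity)]
  nlinarith

/-- The charge given by a finite measure. -/
noncomputable def ofMeasure (ν : Measure X) [IsFiniteMeasure ν] : Charge X where
  toFun := ν.toSignedMeasure
  not_measurable' _ hE := VectorMeasure.not_measurable _ hE
  empty' := VectorMeasure.empty _
  union' _ _ hE hF hd := VectorMeasure.of_union hd hE hF
  bounded' := ⟨ν.real univ, fun E hE => by
    rw [Measure.toSignedMeasure_apply_measurable hE, abs_of_nonneg measureReal_nonneg]
    exact measureReal_mono (subset_univ E)⟩

theorem ofMeasure_apply (ν : Measure X) [IsFiniteMeasure ν] {E : Set X} (hE : MeasurableSet E) :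
    ofMeasure ν E = ν.real E :=
  Measure.toSignedMeasure_apply_measurable hE

theorem ofMeasure_isCountablyAdditive (ν : Measure X) [IsFiniteMeasure ν] :
    (ofMeasure ν).IsCountablyAdditive := fun _ hE hd =>
  ν.toSignedMeasure.hasSum_of_disjoint_iUnion hE hd

theorem simpleIntegral_ofMeasure (ν : Measure X) [IsFiniteMeasure ν] (g : SimpleFunc X ℝ) :
    (ofMeasure ν).simpleIntegral g = ∫ x, g x ∂ν := by
  rw [SimpleFunc.integral_eq_sum _ (SimpleFunc.integrable_of_isFiniteMeasure g), simpleIntegral]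
  refine Finset.sum_congr rfl fun y _ => ?_
  rw [ofMeasure_apply ν (g.measurableSet_fiber y), smul_eq_mul, mul_comm]

theorem _root_.FAMarkov.integrable_of_abs_le {ν : Measure X} [IsFiniteMeasure ν] {f : X → ℝ}
    (hf : Measurable f) {M : ℝ} (hM : ∀ x, |f x| ≤ M) : Integrable f ν :=
  Integrable.of_bound hf.aestronglyMeasurable M (Eventually.of_forall hM)

theorem _root_.FAMarkov.abs_integral_sub_le {ν : Measure X} [IsProbabilityMeasure ν] {f g : X → ℝ}
    (hf : Integrable f ν) (hg : Integrable g ν) {c : ℝ} (h : ∀ x, |f x - g x| ≤ c) :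
    |∫ x, f x ∂ν - ∫ x, g x ∂ν| ≤ c := by
  rw [← integral_sub hf hg]
  have h' : ∀ᵐ x ∂ν, ‖f x - g x‖ ≤ c := Eventually.of_forall h
  simpa using norm_integral_le_of_norm_le_const h'

theorem hasIntegral_ofMeasure (ν : Measure X) [IsFiniteMeasure ν] {f : X → ℝ} (hf : Measurable f)
    (hb : ∃ M, ∀ x, |f x| ≤ M) : (ofMeasure ν).HasIntegral f (∫ x, f x ∂ν) := by
  obtain ⟨I, g, hg, hI⟩ := (ofMeasure ν).exists_hasIntegral hf hb
  obtain ⟨M, hM⟩ := hb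
  refine ⟨g, hg, ?_⟩
  simp only [simpleIntegral_ofMeasure]
  rw [Metric.tendstoUniformly_iff] at hg
  refine tendsto_integral_filter_of_dominated_convergence (fun _ => M + 1)
    (Eventually.of_forall fun n => (g n).measurable.aestronglyMeasurable) ?_ (integrable_const _)
    (Eventually.of_forall fun x => ?_)
  · filter_upwards [hg 1 one_pos] with n hn
    refine Eventually.of_forall fun x => ?_
    have h1 := hn x
    have h2 := hM x
    rw [Real.dist_eq, abs_lt] at h1
    rw [_root_.abs_le] at h2
    rw [Real.norm_eq_abs, _root_.abs_le]
    constructor <;> linarith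
  · rw [Metric.tendsto_nhds]
    intro ε hε
    filter_upwards [hg ε hε] with n hn
    rw [dist_comm]
    exact hn x

theorem IsNonneg.integral_nonneg {μ : Charge X} (hμ : μ.IsNonneg) {f : X → ℝ} (hf : Measurable f)
    (hb : ∃ M, ∀ x, |f x| ≤ M) (h0 : ∀ x, 0 ≤ f x) : 0 ≤ μ.integral f := by
  have hI := μ.hasIntegral_integral hf hb
  obtain ⟨g, hg, -⟩ := μ.hasIntegral_integral hf hb
  -- Since `f ≥ 0`, cutting the approximants off at zero keeps the uniform convergence and makes
  -- every simple integral nonnegative.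
  have hg' : TendstoUniformly (fun n x => (g n ⊔ 0) x) f atTop := by
    rw [Metric.tendstoUniformly_iff] at hg ⊢
    intro ε hε
    filter_upwards [hg ε hε] with n hn x
    have h1 := hn x
    have h2 := h0 x
    rw [Real.dist_eq, abs_lt] at h1 ⊢
    simp only [SimpleFunc.sup_apply, SimpleFunc.coe_zero, Pi.zero_apply]
    rcases le_total (g n x) 0 with h | h
    · rw [sup_of_le_right h]
      constructor <;> linarith
    · rw [sup_of_le_left h]
      exact h1
  refine ge_of_tendsto' (hI.tendsto hg') fun n => Finset.sum_nonneg fun y hy => ?_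
  obtain ⟨x, rfl⟩ := SimpleFunc.mem_range.1 hy
  exact mul_nonneg (by simp) (hμ _ (SimpleFunc.measurableSet_fiber _ _))

/-- A linear combination of charges. -/
noncomputable def linComb (a : ℝ) (μ : Charge X) (b : ℝ) (ν : Charge X) : Charge X where
  toFun E := a * μ E + b * ν E
  not_measurable' E hE := by rw [μ.not_measurable' E hE, ν.not_measurable' E hE]; simp
  empty' := by rw [μ.empty', ν.empty']; simp
  union' E F hE hF hd := by rw [μ.union' E F hE hF hd, ν.union' E F hE hF hd]; ring
  bounded' := by
    obtain ⟨C, hC⟩ := μ.bounded'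
    obtain ⟨D, hD⟩ := ν.bounded'
    refine ⟨|a| * C + |b| * D, fun E hE => (abs_add_le _ _).trans ?_⟩
    rw [abs_mul, abs_mul]
    gcongr
    · exact hC E hE
    · exact hD E hE

theorem linComb_apply (a : ℝ) (μ : Charge X) (b : ℝ) (ν : Charge X) (E : Set X) :
    linComb a μ b ν E = a * μ E + b * ν E := rfl

theorem integral_linComb (a : ℝ) (μ : Charge X) (b : ℝ) (ν : Charge X) {f : X → ℝ}
    (hf : Measurable f) (hb : ∃ M, ∀ x, |f x| ≤ M) :
    (linComb a μ b ν).integral f = a * μ.integral f + b * ν.integral f := by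
  obtain ⟨g, hg, hI⟩ := μ.hasIntegral_integral hf hb
  refine HasIntegral.integral_eq ⟨g, hg, ?_⟩
  have : ∀ n, (linComb a μ b ν).simpleIntegral (g n)
      = a * μ.simpleIntegral (g n) + b * ν.simpleIntegral (g n) := fun n => by
    simp only [simpleIntegral, linComb_apply, Finset.mul_sum, ← Finset.sum_add_distrib]
    exact Finset.sum_congr rfl fun y _ => by ring
  simp only [this]
  exact (hI.const_mul a).add (((ν.hasIntegral_integral hf hb).tendsto hg).const_mul b)

/-- The disjoint differences `G n \ G (n + 1)` exhaust `G 0`, and their masses telescope. -/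
theorem IsCountablyAdditive.tendsto_zero {ν : Charge X} (hν : ν.IsCountablyAdditive)
    {G : ℕ → Set X} (hG : ∀ n, MeasurableSet (G n)) (ha : Antitone G) (h0 : ⋂ n, G n = ∅) :
    Tendsto (fun n => ν (G n)) atTop (𝓝 0) := by
  have hd : Pairwise (Function.onFun Disjoint fun n => G n \ G (n + 1)) := by
    refine (pairwise_disjoint_on _).2 fun m n hmn => ?_
    refine disjoint_left.2 fun x hx hx' => hx.2 (ha (Nat.succ_le_of_lt hmn) hx'.1)
  have hU : ⋃ n, G n \ G (n + 1) = G 0 := by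
    refine Subset.antisymm (iUnion_subset fun n => sdiff_subset.trans (ha n.zero_le)) ?_
    intro x hx
    by_contra hne
    simp only [mem_iUnion, Set.mem_sdiff, not_exists, not_and, not_not] at hne
    have : x ∈ ⋂ n, G n := mem_iInter.2 fun n => by
      induction n with
      | zero => exact hx
      | succ n ih => exact hne n ih
    simp [h0] at this
  have hsum := (hν _ (fun n => (hG n).diff (hG (n + 1))) hd).tendsto_sum_nat
  rw [hU] at hsum
  have hstep : ∀ n, ν (G n \ G (n + 1)) = ν (G n) - ν (G (n + 1)) := fun n => by
    have := ν.union' _ _ ((hG n).diff (hG (n + 1))) (hG (n + 1)) disjoint_sdiff_left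
    rw [sdiff_union_of_subset (ha n.le_succ)] at this
    linarith
  simp only [hstep, Finset.sum_range_sub'] at hsum
  have := (tendsto_const_nhds (x := ν (G 0))).sub hsum
  simpa using this

end Charge

/-! ### Ultralimits of probability measures -/

theorem chargeOperator_apply (κ : Kernel X X) [IsMarkovKernel κ] (μ : Charge X) {E : Set X}
    (hE : MeasurableSet E) : chargeOperator κ μ E = μ.integral fun x => (κ x).real E :=
  if_pos hE

theorem bind_real_apply (κ : Kernel X X) [IsMarkovKernel κ] (ν : Measure X) [IsFiniteMeasure ν]
    {E : Set X} (hE : MeasurableSet E) : (ν.bind κ).real E = ∫ x, (κ x).real E ∂ν := by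
  rw [measureReal_def, Measure.bind_apply hE κ.measurable.aemeasurable]
  refine (integral_toReal (κ.measurable_coe hE).aemeasurable ?_).symm
  exact Eventually.of_forall fun x => measure_lt_top _ _

/-- Compactness of `[0, 1]` gives a limit on each set, and finite additivity survives. Integrals
follow because uniform approximation by simple functions has an error independent of `n`. -/
theorem exists_ultralimit (c : ℕ → Measure X) [∀ n, IsProbabilityMeasure (c n)] :
    ∃ ν : Charge X, ν.IsProbability ∧
      (∀ E, MeasurableSet E →
        Tendsto (fun n => (c n).real E) (hyperfilter ℕ : Filter ℕ) (𝓝 (ν E))) ∧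
      ∀ f : X → ℝ, Measurable f → (∃ M, ∀ x, |f x| ≤ M) →
        Tendsto (fun n => ∫ x, f x ∂(c n)) (hyperfilter ℕ : Filter ℕ) (𝓝 (ν.integral f)) := by
  classical
  have hex : ∀ E, ∃ a ∈ Icc (0 : ℝ) 1,
      Tendsto (fun n => (c n).real E) (hyperfilter ℕ : Filter ℕ) (𝓝 a) := fun E =>
    isCompact_Icc.ultrafilter_le_nhds ((hyperfilter ℕ).map fun n => (c n).real E) <| by
      rw [Ultrafilter.coe_map, le_principal_iff, mem_map]
      exact Eventually.of_forall fun n => ⟨measureReal_nonneg, measureReal_le_one⟩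
  choose L hL hLt using hex
  let ν : Charge X :=
    { toFun := fun E => if MeasurableSet E then L E else 0
      not_measurable' := fun E hE => if_neg hE
      empty' := by
        simp only [MeasurableSet.empty, if_true]
        refine tendsto_nhds_unique (hLt ∅) ?_
        simp
      union' := fun E F hE hF hd => by
        simp only [hE, hF, hE.union hF, if_true]
        refine tendsto_nhds_unique (hLt _) ?_
        simp only [fun n => measureReal_union (μ := c n) hd hF]
        exact (hLt E).add (hLt F)
      bounded' := ⟨1, fun E hE => by
        simp only [hE, if_true]
        exact abs_le.2 ⟨by linarith [(hL E).1], (hL E).2⟩⟩ }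
  have hν : ∀ {E}, MeasurableSet E → ν E = L E := fun hE => if_pos hE
  have hνt : ∀ E, MeasurableSet E →
      Tendsto (fun n => (c n).real E) (hyperfilter ℕ : Filter ℕ) (𝓝 (ν E)) := fun E hE => by
    rw [hν hE]
    exact hLt E
  refine ⟨ν, ⟨fun E hE => ?_, ?_⟩, hνt, fun f hf hb => ?_⟩
  · rw [hν hE]
    exact (hL E).1
  · refine tendsto_nhds_unique (hνt univ MeasurableSet.univ) ?_
    simp
  · have hs : ∀ g : SimpleFunc X ℝ, Tendsto (fun n => ∫ x, g x ∂(c n))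
        (hyperfilter ℕ : Filter ℕ) (𝓝 (ν.simpleIntegral g)) := fun g => by
      simp only [fun n => (Charge.simpleIntegral_ofMeasure (c n) g).symm, Charge.simpleIntegral]
      refine tendsto_finsetSum _ fun y _ => ?_
      simp only [Charge.ofMeasure_apply _ (g.measurableSet_fiber y)]
      exact (hνt _ (g.measurableSet_fiber y)).const_mul y
    obtain ⟨g, hg, hI⟩ := ν.hasIntegral_integral hf hb
    obtain ⟨M, hM⟩ := hb
    rw [Metric.tendstoUniformly_iff] at hg
    rw [Metric.tendsto_nhds]
    intro ε hε
    have hε3 : 0 < ε / 3 := by positivity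
    obtain ⟨m, hm1, hm2⟩ := ((hg _ hε3).and (Metric.tendsto_nhds.1 hI _ hε3)).exists
    filter_upwards [Metric.tendsto_nhds.1 (hs (g m)) _ hε3] with n hn
    have h1 := abs_integral_sub_le (ν := c n) (integrable_of_abs_le hf hM)
      (SimpleFunc.integrable_of_isFiniteMeasure (g m)) fun x => (Real.dist_eq _ _ ▸ hm1 x).le
    rw [Real.dist_eq, abs_lt] at hn hm2 ⊢
    rw [abs_le] at h1
    constructor <;> linarith

/-- Under `ConditionStar`, asymptotically invariant probability measures put asymptotically
no mass on sets that decrease to the empty set. -/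
theorem ConditionStar.not_eventually_le {κ : Kernel X X} [IsMarkovKernel κ]
    (hκ : ConditionStar κ) (c : ℕ → Measure X) [∀ n, IsProbabilityMeasure (c n)]
    (hc : ∀ E, MeasurableSet E →
      Tendsto (fun n => ((c n).bind κ).real E - (c n).real E) atTop (𝓝 0))
    {G : ℕ → Set X} (hG : ∀ n, MeasurableSet (G n)) (ha : Antitone G) (h0 : ⋂ n, G n = ∅)
    {ε : ℝ} (hε : 0 < ε) (h : ∀ m, ∀ᶠ n in atTop, ε ≤ (c n).real (G m)) : False := by
  obtain ⟨ν, hν, hνt, hνi⟩ := exists_ultralimit c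
  have hle : (hyperfilter ℕ : Filter ℕ) ≤ atTop := Nat.hyperfilter_le_atTop
  have hinv : ν ∈ invariantCharges κ := by
    refine ⟨hν, Charge.ext fun E hE => ?_⟩
    rw [chargeOperator_apply κ _ hE]
    -- The value of the operator at `ν` on `E` is the ultralimit of `((c n).bind κ).real E`, which
    -- by `hc` agrees with that of `(c n).real E`.
    have h1 := hνi _ (measurable_kernel_real κ hE) ⟨1, abs_kernel_real_le κ E⟩
    simp only [← fun n => bind_real_apply κ (c n) hE] at h1
    have h2 := ((hc E hE).mono_left hle).add (hνt E hE)
    simp only [sub_add_cancel, zero_add] at h2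
    exact tendsto_nhds_unique h1 h2
  have hlim := (hκ hinv).tendsto_zero hG ha h0
  obtain ⟨m, hm⟩ := (hlim.eventually_lt_const hε).exists
  exact absurd (ge_of_tendsto (hνt _ (hG m)) (hle (h m))) (not_le.2 hm)

/-! ### Cesàro averages and Doeblin's condition -/

instance isMarkovKernel_pow (κ : Kernel X X) [IsMarkovKernel κ] (n : ℕ) :
    IsMarkovKernel (κ ^ n) := by
  induction n with
  | zero => exact (inferInstance : IsMarkovKernel (Kernel.id : Kernel X X))
  | succ n ih =>
    rw [Kernel.pow_add κ n 1, pow_one]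
    infer_instance

theorem pow_add_real_apply (κ : Kernel X X) [IsMarkovKernel κ] (m n : ℕ) (x : X) {E : Set X}
    (hE : MeasurableSet E) :
    ((κ ^ (m + n)) x).real E = ∫ y, ((κ ^ n) y).real E ∂((κ ^ m) x) := by
  rw [← bind_real_apply _ _ hE, measureReal_def, measureReal_def,
    Kernel.pow_add_apply_eq_lintegral κ m n x hE,
    Measure.bind_apply hE (κ ^ n).measurable.aemeasurable]

/-- The average of the transition probabilities of the first `N` steps. -/
noncomputable def cesaro (κ : Kernel X X) (N : ℕ) (x : X) : Measure X :=
  (N : ℝ≥0∞)⁻¹ • ∑ j ∈ Finset.range N, (κ ^ (j + 1)) x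

theorem cesaro_real_apply (κ : Kernel X X) [IsMarkovKernel κ] (N : ℕ) (x : X) (E : Set X) :
    (cesaro κ N x).real E = (N : ℝ)⁻¹ * ∑ j ∈ Finset.range N, ((κ ^ (j + 1)) x).real E := by
  rw [cesaro, measureReal_ennreal_smul_apply, ENNReal.toReal_inv, ENNReal.toReal_natCast,
    measureReal_def, Measure.finsetSum_apply,
    ENNReal.toReal_sum fun _ _ => measure_ne_top _ _]
  rfl

instance isProbabilityMeasure_cesaro (κ : Kernel X X) [IsMarkovKernel κ] (n : ℕ) (x : X) :
    IsProbabilityMeasure (cesaro κ (n + 1) x) := by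
  refine ⟨?_⟩
  simp only [cesaro, Measure.smul_apply, Measure.finsetSum_apply, measure_univ, Finset.sum_const,
    Finset.card_range, smul_eq_mul, nsmul_eq_mul, mul_one]
  exact ENNReal.inv_mul_cancel (by simp) (by finiteness)

/-- One more step shifts the average by one index, so the difference telescopes. The resulting bound
is uniform in `x`, so the starting point may vary with `n`. -/
theorem cesaro_bind_sub (κ : Kernel X X) [IsMarkovKernel κ] (n : ℕ) (x : X) {E : Set X}
    (hE : MeasurableSet E) :
    ((cesaro κ (n + 1) x).bind κ).real E - (cesaro κ (n + 1) x).real E =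
      ((n + 1 : ℕ) : ℝ)⁻¹ * (((κ ^ (n + 2)) x).real E - (κ x).real E) := by
  have hi : ∀ j ∈ Finset.range (n + 1), Integrable (fun y => (κ y).real E) ((κ ^ (j + 1)) x) :=
    fun j _ => integrable_of_abs_le (measurable_kernel_real κ hE) (abs_kernel_real_le κ E)
  rw [bind_real_apply κ _ hE, cesaro_real_apply]
  rw [cesaro, integral_smul_measure, integral_finsetSum_measure hi, ENNReal.toReal_inv,
    ENNReal.toReal_natCast, smul_eq_mul, ← mul_sub, ← Finset.sum_sub_distrib]
  congr 1
  have : ∀ j, ∫ y, (κ y).real E ∂((κ ^ (j + 1)) x) = ((κ ^ (j + 1 + 1)) x).real E := fun j => by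
    rw [pow_add_real_apply κ (j + 1) 1 x hE, pow_one]
  simp only [this]
  rw [Finset.sum_range_sub (fun j => ((κ ^ (j + 1)) x).real E)]
  simp

theorem tendsto_cesaro_bind_sub (κ : Kernel X X) [IsMarkovKernel κ] (x : ℕ → X) {E : Set X}
    (hE : MeasurableSet E) :
    Tendsto (fun n => ((cesaro κ (n + 1) (x n)).bind κ).real E - (cesaro κ (n + 1) (x n)).real E)
      atTop (𝓝 0) := by
  refine squeeze_zero_norm (a := fun n : ℕ => 1 / ((n : ℝ) + 1)) (fun n => ?_)
    tendsto_one_div_add_atTop_nhds_zero_nat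
  rw [cesaro_bind_sub κ n _ hE, norm_mul, one_div, norm_inv, Real.norm_natCast, Nat.cast_succ]
  refine mul_le_of_le_one_right (by positivity) (abs_le.2 ⟨?_, ?_⟩)
  · linarith [measureReal_nonneg (μ := (κ ^ (n + 2)) (x n)) (s := E),
      measureReal_le_one (μ := κ (x n)) (s := E)]
  · linarith [measureReal_nonneg (μ := κ (x n)) (s := E),
      measureReal_le_one (μ := (κ ^ (n + 2)) (x n)) (s := E)]

/-- Under `ConditionStar` the averaged transition probabilities satisfy Doeblin's condition. -/
theorem ConditionStar.exists_cesaro_le {κ : Kernel X X} [IsMarkovKernel κ]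
    (hκ : ConditionStar κ) {ε : ℝ} (hε : 0 < ε) :
    ∃ (N : ℕ) (φ : Measure X) (δ : ℝ≥0∞), IsFiniteMeasure φ ∧ 0 < δ ∧
      ∀ E, MeasurableSet E → φ E < δ → ∀ x, (cesaro κ (N + 1) x).real E ≤ ε := by
  by_contra! hcon
  have hex : ∀ (φ : {φ : Measure X // IsFiniteMeasure φ}) (n : ℕ), ∃ (E : Set X) (x : X),
      MeasurableSet E ∧ φ.1 E < 2⁻¹ ^ n ∧ ε < (cesaro κ (n + 1) x).real E := fun φ n => by
    obtain ⟨E, hE, hlt, x, hx⟩ := hcon n φ.1 (2⁻¹ ^ n) φ.2 (ENNReal.pow_pos (by simp) n)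
    exact ⟨E, x, hE, hlt, hx⟩
  choose E₀ x₀ hE₀ hlt₀ hgt₀ using hex
  -- `φ n` is the sum of the averages chosen before stage `n`, so a set that is small for `φ n` is
  -- small for all of them.
  let φ : ℕ → {φ : Measure X // IsFiniteMeasure φ} := fun n => Nat.rec ⟨0, inferInstance⟩
    (fun n ψ => ⟨ψ.1 + cesaro κ (n + 1) (x₀ ψ n), have := ψ.2; inferInstance⟩) n
  let E : ℕ → Set X := fun n => E₀ (φ n) n
  let c : ℕ → Measure X := fun n => cesaro κ (n + 1) (x₀ (φ n) n)
  have hφ : ∀ n, (φ (n + 1)).1 = (φ n).1 + c n := fun n => rfl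
  have hE : ∀ n, MeasurableSet (E n) := fun n => hE₀ _ _
  have hmono : Monotone fun n => (φ n).1 := monotone_nat_of_le_succ fun n => by
    rw [hφ]
    exact Measure.le_add_right le_rfl
  -- The factor `2 ^ k` makes the bound trivial for `n ≤ k`; all that matters is summability in `n`
  -- for fixed `k`, needed for Borel–Cantelli.
  have hcE : ∀ k n, c k (E n) ≤ 2 ^ k * 2⁻¹ ^ n := fun k n => by
    rcases le_or_gt n k with h | h
    · refine (prob_le_one (μ := c k)).trans ?_
      rw [← ENNReal.inv_pow]
      refine le_trans (ENNReal.mul_inv_cancel (a := 2 ^ n) (by simp) (by simp)).ge ?_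
      gcongr
      exact one_le_two
    · have h1 : c k ≤ (φ n).1 := (Measure.le_add_left le_rfl).trans ((hφ k).ge.trans (hmono h))
      refine ((h1 _).trans (hlt₀ (φ n) n).le).trans ?_
      exact le_mul_of_one_le_left' (one_le_pow₀ one_le_two)
  let F : Set X := limsup E atTop
  have hF : MeasurableSet F := .measurableSet_limsup hE
  have hcF : ∀ k, c k F = 0 := fun k => by
    refine measure_limsup_atTop_eq_zero (ne_top_of_le_ne_top ?_ (ENNReal.tsum_le_tsum (hcE k)))
    rw [ENNReal.tsum_mul_left, ENNReal.tsum_geometric]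
    simp only [ENNReal.one_sub_inv_two, inv_inv]
    finiteness
  -- Removing the limsup makes the intersection empty, and costs no mass since each `c k` vanishes
  -- on it.
  let G : ℕ → Set X := fun m => (⋃ n ≥ m, E n) \ F
  refine hκ.not_eventually_le c (fun A hA => tendsto_cesaro_bind_sub κ _ hA) (G := G)
    (fun m => (MeasurableSet.biUnion (to_countable _) fun n _ => hE n).diff hF) ?_ ?_ hε ?_
  · intro m m' hm
    exact sdiff_subset_sdiff_left (biUnion_subset_biUnion_left fun n hn => le_trans hm hn)
  · have hFG : F = ⋂ m, ⋃ n ≥ m, E n := limsup_eq_iInf_iSup_of_nat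
    refine eq_empty_of_forall_notMem fun y hy => ?_
    rw [mem_iInter] at hy
    exact (hy 0).2 (hFG ▸ mem_iInter.2 fun m => (hy m).1)
  · intro m
    filter_upwards [eventually_ge_atTop m] with n hn
    refine (hgt₀ (φ n) n).le.trans ?_
    change (c n).real (E n) ≤ _
    rw [measureReal_def, measureReal_def]
    refine ENNReal.toReal_mono (measure_ne_top _ _) ?_
    rw [measure_sdiff_null (hcF n)]
    exact measure_mono (subset_biUnion_of_mem (u := E) hn)

/-- Under `ConditionStar` some power of the kernel satisfies Doeblin's condition. -/
theorem ConditionStar.exists_pow_le {κ : Kernel X X} [IsMarkovKernel κ]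
    (hκ : ConditionStar κ) {ε : ℝ} (hε : 0 < ε) :
    ∃ (m : ℕ) (φ : Measure X) (δ : ℝ≥0∞), 1 ≤ m ∧ IsFiniteMeasure φ ∧ 0 < δ ∧
      ∀ E, MeasurableSet E → φ E < δ → ∀ x, ((κ ^ m) x).real E ≤ ε := by
  obtain ⟨N, φ, δ, hφ, hδ, h⟩ := hκ.exists_cesaro_le (half_pos hε)
  have hc0 : ENNReal.ofReal (ε / 2) ≠ 0 := by simpa using hε
  -- With this measure and threshold, Markov's inequality gives `φ D < δ` for the set `D` of points
  -- from which some `κ ^ i`, `i ≤ N`, charges `E` with at least `ε / 2`.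
  refine ⟨N + 1, ∑ i ∈ Finset.range (N + 1), φ.bind ⇑(κ ^ i), δ * ENNReal.ofReal (ε / 2),
    le_add_self, inferInstance, ENNReal.mul_pos hδ.ne' hc0, fun E hE hlt x => ?_⟩
  let S : ℕ → Set X := fun i => {y | ENNReal.ofReal (ε / 2) ≤ (κ ^ i) y E}
  have hS : ∀ i, MeasurableSet (S i) := fun i =>
    measurableSet_le measurable_const ((κ ^ i).measurable_coe hE)
  let D : Set X := ⋃ i ∈ Finset.range (N + 1), S i
  have hD : MeasurableSet D := Finset.measurableSet_biUnion _ fun i _ => hS i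
  have hφD : φ D < δ := by
    have h1 : φ D ≤ ∑ i ∈ Finset.range (N + 1), φ.bind ⇑(κ ^ i) E / ENNReal.ofReal (ε / 2) := by
      refine (measure_biUnion_finset_le _ _).trans (Finset.sum_le_sum fun i _ => ?_)
      rw [Measure.bind_apply hE (κ ^ i).measurable.aemeasurable]
      exact meas_ge_le_lintegral_div ((κ ^ i).measurable_coe hE).aemeasurable hc0
        ENNReal.ofReal_ne_top
    simp only [ENNReal.div_eq_inv_mul, ← Finset.mul_sum] at h1
    refine h1.trans_lt ?_
    rw [← ENNReal.div_eq_inv_mul, ENNReal.div_lt_iff (.inl hc0) (.inl ENNReal.ofReal_ne_top)]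
    simpa [Measure.finsetSum_apply] using hlt
  -- Splitting the `N + 1` steps after step `j + 1` leaves `i ≤ N` steps, which reach `E` with
  -- probability below `ε / 2` when started off `D`. Averaging over `j` brings in the Cesàro mass of
  -- `D`.
  have hstep : ∀ j ∈ Finset.range (N + 1),
      ((κ ^ (N + 1)) x).real E ≤ ε / 2 + ((κ ^ (j + 1)) x).real D := fun j hj => by
    obtain ⟨i, hi⟩ : ∃ i, N + 1 = (j + 1) + i :=
      Nat.exists_eq_add_of_le (Nat.succ_le_of_lt (Finset.mem_range.1 hj))
    have hiN : i ∈ Finset.range (N + 1) := Finset.mem_range.2 (by omega)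
    rw [hi, pow_add_real_apply κ (j + 1) i x hE]
    have hint : Integrable (fun y => ε / 2 + D.indicator 1 y) ((κ ^ (j + 1)) x) :=
      (integrable_const _).add ((integrable_const (1 : ℝ)).indicator hD)
    refine (integral_mono (integrable_of_abs_le (measurable_kernel_real _ hE)
      (abs_kernel_real_le _ E)) hint fun y => ?_).trans_eq ?_
    · by_cases hy : y ∈ D
      · simp only [indicator_of_mem hy, Pi.one_apply]
        linarith [measureReal_le_one (μ := (κ ^ i) y) (s := E)]
      · simp only [indicator_of_notMem hy, add_zero]
        have hyS : y ∉ S i := fun h' => hy (mem_biUnion hiN h')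
        exact ENNReal.toReal_le_of_le_ofReal (half_pos hε).le (not_le.1 hyS).le
    · rw [integral_add (integrable_const _) (f := fun _ => ε / 2) (g := D.indicator 1)
        ((integrable_const (1 : ℝ)).indicator hD), integral_indicator_one hD]
      simp
  have hsum := Finset.sum_le_sum hstep
  have hD' := h D hD hφD x
  rw [cesaro_real_apply] at hD'
  rw [Finset.sum_add_distrib] at hsum
  simp only [Finset.sum_const, Finset.card_range, nsmul_eq_mul] at hsum
  have hN : (0 : ℝ) < ((N + 1 : ℕ) : ℝ) := by positivity
  rw [inv_mul_le_iff₀ hN] at hD'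
  nlinarith

/-! ### Finite-rank approximation of densities on the product -/

/-- The kernel `k` is approximately annihilated by the functions `w` whose integrals over the
members of a suitable finite family of sets vanish. -/
def FinitelyApproximable (φ ψ : Measure X) (k : X × X → ℝ) : Prop :=
  ∀ η : ℝ, 0 < η → ∃ 𝓑 : Finset (Set X), (∀ B ∈ 𝓑, MeasurableSet B) ∧
    ∀ s w : X → ℝ, Measurable s → Measurable w → (∀ x, |s x| ≤ 1) → (∀ x, |w x| ≤ 1) →
      (∀ B ∈ 𝓑, ∫ x in B, w x ∂ψ = 0) →
      |∫ z, (s z.1 * w z.2) * k z ∂(φ.prod ψ)| ≤ η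

section ProductApproximation

variable {φ ψ : Measure X}

theorem abs_mul_le_one {a b : ℝ} (ha : |a| ≤ 1) (hb : |b| ≤ 1) : |a * b| ≤ 1 := by
  rw [abs_mul]
  exact mul_le_one₀ ha (abs_nonneg _) hb

theorem integrable_test_mul {P : Measure (X × X)} {s w : X → ℝ} (hs : Measurable s)
    (hw : Measurable w) (hs1 : ∀ x, |s x| ≤ 1) (hw1 : ∀ x, |w x| ≤ 1) {k : X × X → ℝ}
    (hk : Integrable k P) : Integrable (fun z => (s z.1 * w z.2) * k z) P :=
  hk.bdd_mul (c := 1) ((hs.comp measurable_fst).mul (hw.comp measurable_snd)).aestronglyMeasurable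
    (Eventually.of_forall fun _ => abs_mul_le_one (hs1 _) (hw1 _))

theorem FinitelyApproximable.of_integral_norm_sub_le {k : X × X → ℝ}
    (hk : Integrable k (φ.prod ψ))
    (h : ∀ η : ℝ, 0 < η → ∃ k', Integrable k' (φ.prod ψ) ∧ FinitelyApproximable φ ψ k' ∧
      ∫ z, ‖k z - k' z‖ ∂(φ.prod ψ) ≤ η) : FinitelyApproximable φ ψ k := by
  intro η hη
  obtain ⟨k', hk', ha, hkk⟩ := h (η / 2) (half_pos hη)
  obtain ⟨𝓑, h𝓑, hB⟩ := ha (η / 2) (half_pos hη)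
  refine ⟨𝓑, h𝓑, fun s w hs hw hs1 hw1 h0 => ?_⟩
  have h1 := hB s w hs hw hs1 hw1 h0
  have h2 : |∫ z, (s z.1 * w z.2) * (k z - k' z) ∂(φ.prod ψ)| ≤ η / 2 := by
    refine le_trans (norm_integral_le_of_norm_le (G := ℝ) (g := fun z => ‖k z - k' z‖)
      (hk.sub hk').norm (Eventually.of_forall fun z => ?_)) hkk
    rw [norm_mul]
    exact mul_le_of_le_one_left (norm_nonneg _) (abs_mul_le_one (hs1 _) (hw1 _))
  simp only [mul_sub] at h2
  rw [integral_sub (integrable_test_mul hs hw hs1 hw1 hk)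
    (integrable_test_mul hs hw hs1 hw1 hk')] at h2
  rw [abs_le] at h1 h2 ⊢
  constructor <;> linarith

theorem FinitelyApproximable.add {k k' : X × X → ℝ} (hk : Integrable k (φ.prod ψ))
    (hk' : Integrable k' (φ.prod ψ)) (h : FinitelyApproximable φ ψ k)
    (h' : FinitelyApproximable φ ψ k') : FinitelyApproximable φ ψ (k + k') := by
  classical
  intro η hη
  obtain ⟨𝓑, h𝓑, hB⟩ := h (η / 2) (half_pos hη)
  obtain ⟨𝓑', h𝓑', hB'⟩ := h' (η / 2) (half_pos hη)
  refine ⟨𝓑 ∪ 𝓑', fun B hB => (Finset.mem_union.1 hB).elim (h𝓑 B) (h𝓑' B),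
    fun s w hs hw hs1 hw1 h0 => ?_⟩
  have h1 := hB s w hs hw hs1 hw1 fun B hB => h0 B (Finset.mem_union_left _ hB)
  have h2 := hB' s w hs hw hs1 hw1 fun B hB => h0 B (Finset.mem_union_right _ hB)
  simp only [Pi.add_apply, mul_add]
  rw [integral_add (integrable_test_mul hs hw hs1 hw1 hk)
    (integrable_test_mul hs hw hs1 hw1 hk')]
  exact (abs_add_le _ _).trans (by linarith)

theorem FinitelyApproximable.const_mul {k : X × X → ℝ} (h : FinitelyApproximable φ ψ k) (c : ℝ) :
    FinitelyApproximable φ ψ fun z => c * k z := by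
  intro η hη
  obtain ⟨𝓑, h𝓑, hB⟩ := h (η / (|c| + 1)) (by positivity)
  refine ⟨𝓑, h𝓑, fun s w hs hw hs1 hw1 h0 => ?_⟩
  have h1 := hB s w hs hw hs1 hw1 h0
  simp only [mul_left_comm _ c]
  rw [integral_const_mul, abs_mul]
  rw [le_div_iff₀ (by positivity)] at h1
  nlinarith [abs_nonneg (∫ z, (s z.1 * w z.2) * k z ∂(φ.prod ψ))]

theorem finitelyApproximable_zero : FinitelyApproximable φ ψ 0 := fun η hη =>
  ⟨∅, by simp, fun s w _ _ _ _ _ => by simpa using hη.le⟩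

variable [IsFiniteMeasure φ] [IsFiniteMeasure ψ]

theorem integrable_indicator_one {S : Set (X × X)} (hS : MeasurableSet S) :
    Integrable (S.indicator (1 : X × X → ℝ)) (φ.prod ψ) :=
  (integrable_const (1 : ℝ)).indicator hS

/-- The double integral factorises, and one factor is the integral of `w` over `B`. -/
theorem finitelyApproximable_indicator_prod {A B : Set X} (hB : MeasurableSet B) :
    FinitelyApproximable φ ψ ((A ×ˢ B).indicator 1) := by
  intro η hη
  refine ⟨{B}, by simpa using hB, fun s w hs hw hs1 hw1 h0 => ?_⟩
  have : (fun z : X × X => (s z.1 * w z.2) * (A ×ˢ B).indicator 1 z)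
      = fun z => (s z.1 * A.indicator 1 z.1) * B.indicator w z.2 := by
    funext z
    by_cases h1 : z.1 ∈ A <;> by_cases h2 : z.2 ∈ B <;> simp [indicator, h1, h2]
  rw [this, integral_prod_mul (fun y => s y * A.indicator 1 y) (B.indicator w),
    integral_indicator hB, h0 B (Finset.mem_singleton_self B)]
  simpa using hη.le

theorem finitelyApproximable_indicator {S : Set (X × X)} (hS : MeasurableSet S) :
    FinitelyApproximable φ ψ (S.indicator 1) := by
  induction S, hS using MeasurableSpace.induction_on_inter generateFrom_prod.symm isPiSystem_prod with
  | empty =>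
    rw [indicator_empty']
    exact finitelyApproximable_zero
  | basic S hS =>
    obtain ⟨A, -, B, hB, rfl⟩ := hS
    exact finitelyApproximable_indicator_prod hB
  | compl S hS ih =>
    have h1 : FinitelyApproximable φ ψ 1 := by
      simpa using finitelyApproximable_indicator_prod (φ := φ) (ψ := ψ) (A := univ) (B := univ)
        .univ
    have := h1.add (integrable_const 1) ((integrable_indicator_one hS).const_mul (-1))
      (ih.const_mul (-1))
    convert this using 1
    funext z
    by_cases hz : z ∈ S <;> simp [hz]
  | iUnion f hd hf ih =>
    refine .of_integral_norm_sub_le (integrable_indicator_one (.iUnion hf)) fun η hη => ?_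
    have hsum : ∀ n, FinitelyApproximable φ ψ ((⋃ i ∈ Finset.range n, f i).indicator 1) ∧
        MeasurableSet (⋃ i ∈ Finset.range n, f i) := fun n => by
      refine ⟨?_, Finset.measurableSet_biUnion _ fun i _ => hf i⟩
      induction n with
      | zero =>
        simp only [Finset.range_zero, Finset.notMem_empty, iUnion_of_empty, iUnion_empty,
          indicator_empty']
        exact finitelyApproximable_zero
      | succ n ihn =>
        have hm : MeasurableSet (⋃ i ∈ Finset.range n, f i) :=
          Finset.measurableSet_biUnion _ fun i _ => hf i
        have := ihn.add (integrable_indicator_one hm) (integrable_indicator_one (hf n)) (ih n)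
        rw [Finset.range_add_one, Finset.set_biUnion_insert, union_comm,
          indicator_union_of_disjoint]
        · exact this
        · rw [disjoint_iUnion₂_left]
          exact fun i hi => hd (Finset.mem_range.1 hi).ne
    have hlim : Tendsto (fun n => (φ.prod ψ).real ((⋃ i, f i) \ ⋃ i ∈ Finset.range n, f i))
        atTop (𝓝 0) := by
      have h0 := tendsto_measure_iInter_atTop (μ := φ.prod ψ)
        (s := fun n => (⋃ i, f i) \ ⋃ i ∈ Finset.range n, f i)
        (fun n => ((MeasurableSet.iUnion hf).diff (hsum n).2).nullMeasurableSet)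
        (fun m n hmn => sdiff_subset_sdiff_right
          (biUnion_subset_biUnion_left (Finset.range_mono hmn))) ⟨0, measure_ne_top _ _⟩
      have he : ⋂ n, ((⋃ i, f i) \ ⋃ i ∈ Finset.range n, f i) = ∅ := by
        refine eq_empty_of_forall_notMem fun z hz => ?_
        rw [mem_iInter] at hz
        obtain ⟨i, hi⟩ := mem_iUnion.1 (hz 0).1
        exact (hz (i + 1)).2 (mem_biUnion (Finset.mem_range.2 i.lt_succ_self) hi)
      rw [he, measure_empty] at h0
      exact (ENNReal.tendsto_toReal ENNReal.zero_ne_top).comp h0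
    obtain ⟨n, hn⟩ := (hlim.eventually_lt_const hη).exists
    refine ⟨_, integrable_indicator_one (hsum n).2, (hsum n).1, le_of_eq_of_le ?_ hn.le⟩
    rw [← integral_indicator_one ((MeasurableSet.iUnion hf).diff (hsum n).2)]
    congr 1
    funext z
    by_cases h1 : z ∈ ⋃ i ∈ Finset.range n, f i
    · have h2 : z ∈ ⋃ i, f i := iUnion₂_subset_iUnion _ _ h1
      rw [indicator_of_mem h1, indicator_of_mem h2, indicator_of_notMem fun h => h.2 h1]
      simp
    · by_cases h2 : z ∈ ⋃ i, f i
      · rw [indicator_of_notMem h1, indicator_of_mem h2, indicator_of_mem (mem_sdiff_of_mem h2 h1)]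
        simp
      · rw [indicator_of_notMem h1, indicator_of_notMem h2, indicator_of_notMem fun h => h2 h.1]
        simp

theorem finitelyApproximable_of_integrable {k : X × X → ℝ} (hk : Integrable k (φ.prod ψ)) :
    FinitelyApproximable φ ψ k := by
  refine Integrable.induction (FinitelyApproximable φ ψ) ?_ ?_ ?_ ?_ hk
  · intro c S hS _
    convert (finitelyApproximable_indicator (φ := φ) (ψ := ψ) hS).const_mul c using 1
    funext z
    by_cases hz : z ∈ S <;> simp [hz]
  · intro f g _ hf hg hf' hg'
    exact hf'.add hf hg hg'
  · refine isClosed_of_closure_subset fun f hf => ?_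
    refine .of_integral_norm_sub_le (L1.integrable_coeFn f) fun η hη => ?_
    obtain ⟨g, hg, hfg⟩ := Metric.mem_closure_iff.1 hf η hη
    refine ⟨g, L1.integrable_coeFn g, hg, ?_⟩
    rw [dist_eq_norm, L1.norm_eq_integral_norm] at hfg
    refine le_of_eq_of_le (integral_congr_ae ?_) hfg.le
    filter_upwards [Lp.coeFn_sub f g] with z hz
    rw [hz, Pi.sub_apply]
  · intro f g hfg _ hf η hη
    obtain ⟨𝓑, h𝓑, hB⟩ := hf η hη
    refine ⟨𝓑, h𝓑, fun s w hs hw hs1 hw1 h0 => ?_⟩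
    have he : (fun z => (s z.1 * w z.2) * f z) =ᵐ[φ.prod ψ] fun z => (s z.1 * w z.2) * g z := by
      filter_upwards [hfg] with z hz
      rw [hz]
    rw [← integral_congr_ae he]
    exact hB s w hs hw hs1 hw1 h0

/-- The singular part lives on a `φ.prod ψ`-null set. By Fubini almost all its sections are
`ψ`-null, so `K y` gives them at most `r`. -/
theorem singularPart_compProd_le (K : Kernel X X) [IsMarkovKernel K] {r : ℝ≥0∞}
    (hr : ∀ E, MeasurableSet E → ψ E = 0 → ∀ x, K x E ≤ r) :
    (φ ⊗ₘ K).singularPart (φ.prod ψ) univ ≤ r * φ univ := by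
  obtain ⟨S, hS, hS0, hSc⟩ := Measure.mutuallySingular_singularPart (φ ⊗ₘ K) (φ.prod ψ)
  have h1 : (φ ⊗ₘ K).singularPart (φ.prod ψ) univ ≤ (φ ⊗ₘ K) Sᶜ := by
    rw [← union_compl_self S]
    refine (measure_union_le _ _).trans ?_
    rw [hS0, zero_add]
    exact Measure.singularPart_le _ _ _
  refine h1.trans ?_
  rw [Measure.compProd_apply hS.compl, ← lintegral_const]
  refine lintegral_mono_ae ?_
  filter_upwards [(Measure.measure_prod_null hS.compl).1 hSc] with y hy
  exact hr _ (measurable_prodMk_left hS.compl) hy y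

theorem exists_finset_integral_abs_le (K : Kernel X X) [IsMarkovKernel K] {r : ℝ} (hr0 : 0 ≤ r)
    (hr : ∀ E, MeasurableSet E → ψ E = 0 → ∀ x, (K x).real E ≤ r) {η : ℝ} (hη : 0 < η) :
    ∃ 𝓑 : Finset (Set X), (∀ B ∈ 𝓑, MeasurableSet B) ∧
      ∀ w : X → ℝ, Measurable w → (∀ x, |w x| ≤ 1) → (∀ B ∈ 𝓑, ∫ x in B, w x ∂ψ = 0) →
        ∫ y, |∫ z, w z ∂(K y)| ∂φ ≤ r * φ.real univ + η := by
  set P := φ.prod ψ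
  set M := φ ⊗ₘ K
  have hk : Integrable (fun z => (M.rnDeriv P z).toReal) P := Measure.integrable_toReal_rnDeriv
  obtain ⟨𝓑, h𝓑, hB⟩ := finitelyApproximable_of_integrable hk η hη
  refine ⟨𝓑, h𝓑, fun w hw hw1 h0 => ?_⟩
  have hKw : Measurable fun y => ∫ z, w z ∂(K y) :=
    (hw.stronglyMeasurable.integral_kernel (κ := K)).measurable
  -- The sign turns the `L¹(φ)` norm of `K w` into an integral of `s ⊗ w` against `φ ⊗ₘ K`, to be
  -- split by Lebesgue decomposition.
  let s : X → ℝ := fun y => if 0 ≤ ∫ z, w z ∂(K y) then 1 else -1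
  have hs : Measurable s := Measurable.ite (measurableSet_le measurable_const hKw)
    measurable_const measurable_const
  have hs1 : ∀ y, |s y| ≤ 1 := fun y => by
    simp only [s]
    split_ifs <;> simp
  have habs : ∀ y, |∫ z, w z ∂(K y)| = ∫ z, s y * w z ∂(K y) := fun y => by
    rw [integral_const_mul]
    simp only [s]
    split_ifs with h
    · rw [abs_of_nonneg h, one_mul]
    · rw [abs_of_neg (not_le.1 h), neg_one_mul]
  have hint : ∀ (Q : Measure (X × X)) [IsFiniteMeasure Q],
      Integrable (fun z : X × X => s z.1 * w z.2) Q := fun Q _ =>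
    integrable_of_abs_le ((hs.comp measurable_fst).mul (hw.comp measurable_snd))
      fun z => abs_mul_le_one (hs1 _) (hw1 _)
  simp only [habs]
  rw [← Measure.integral_compProd (f := fun z : X × X => s z.1 * w z.2) (hint _)]
  change ∫ z, s z.1 * w z.2 ∂M ≤ _
  rw [Measure.haveLebesgueDecomposition_add M P, integral_add_measure (hint _) (hint _),
    integral_withDensity_eq_integral_toReal_smul (Measure.measurable_rnDeriv _ _)
      (Measure.rnDeriv_lt_top _ _)]
  refine add_le_add ?_ ?_
  · have h1 : ‖∫ z, s z.1 * w z.2 ∂(M.singularPart P)‖ ≤ 1 * (M.singularPart P).real univ :=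
      norm_integral_le_of_norm_le_const (Eventually.of_forall fun z =>
        abs_mul_le_one (hs1 _) (hw1 _))
    refine ((le_abs_self _).trans h1).trans ?_
    rw [one_mul, measureReal_def, measureReal_def, ← ENNReal.toReal_ofReal hr0,
      ← ENNReal.toReal_mul]
    refine ENNReal.toReal_mono (by finiteness) (singularPart_compProd_le K fun E hE h x => ?_)
    rw [← ofReal_measureReal]
    exact ENNReal.ofReal_le_ofReal (hr E hE h x)
  · refine (le_abs_self _).trans (le_of_eq_of_le ?_ (hB s w hs hw hs1 hw1 h0))
    simp only [smul_eq_mul, mul_comm, P]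

end ProductApproximation

/-! ### From smallness in the mean to uniform smallness -/

/-- Under `ConditionStar` a power of the transition operator is small, uniformly in the starting
point, on the bounded functions annihilated by finitely many functionals. -/
theorem ConditionStar.exists_finset_abs_integral_le {κ : Kernel X X} [IsMarkovKernel κ]
    (hκ : ConditionStar κ) {ε : ℝ} (hε : 0 < ε) :
    ∃ (k : ℕ) (ψ : Measure X) (𝓑 : Finset (Set X)), 1 ≤ k ∧ IsFiniteMeasure ψ ∧
      (∀ B ∈ 𝓑, MeasurableSet B) ∧
      ∀ w : X → ℝ, Measurable w → (∀ x, |w x| ≤ 1) → (∀ B ∈ 𝓑, ∫ x in B, w x ∂ψ = 0) →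
        ∀ x, |∫ z, w z ∂((κ ^ k) x)| ≤ ε := by
  obtain ⟨m, φ, δ₀, hm, hφ, hδ₀, hD⟩ := hκ.exists_pow_le (half_pos hε)
  obtain ⟨δ, hδ, hδδ₀⟩ : ∃ δ : ℝ, 0 < δ ∧ ENNReal.ofReal δ ≤ δ₀ := by
    obtain ⟨d, hd, hd'⟩ := ENNReal.lt_iff_exists_nnreal_btwn.1 hδ₀
    exact ⟨d, by exact_mod_cast hd, by simpa using hd'.le⟩
  have hφ1 : 0 < φ.real univ + 1 := by positivity
  -- Singular and absolutely continuous parts then cost `δ * ε / 8` each, so Markov's inequality at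
  -- level `ε / 2` gives `φ D ≤ δ / 2`. The `+ 1` covers `φ = 0`.
  let r : ℝ := δ * ε / 8 / (φ.real univ + 1)
  have hr : 0 < r := by positivity
  obtain ⟨m', ψ, δ', -, hψ, hδ', hD'⟩ := hκ.exists_pow_le hr
  obtain ⟨𝓑, h𝓑, hB⟩ := exists_finset_integral_abs_le (φ := φ) (ψ := ψ) (κ ^ m') hr.le
    (fun E hE h => hD' E hE (h ▸ hδ')) (η := δ * ε / 8) (by positivity)
  refine ⟨m + m', ψ, 𝓑, by omega, hψ, h𝓑, fun w hw hw1 h0 x => ?_⟩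
  let v : X → ℝ := fun y => ∫ z, w z ∂((κ ^ m') y)
  have hv : Measurable v := (hw.stronglyMeasurable.integral_kernel (κ := κ ^ m')).measurable
  have hv1 : ∀ y, |v y| ≤ 1 := fun y => by
    have : ∀ᵐ z ∂((κ ^ m') y), ‖w z‖ ≤ 1 := Eventually.of_forall hw1
    simpa using norm_integral_le_of_norm_le_const this
  have hvφ : ∫ y, |v y| ∂φ ≤ δ * ε / 4 := by
    refine (hB w hw hw1 h0).trans ?_
    have : r * φ.real univ ≤ δ * ε / 8 := by
      simp only [r]
      rw [div_mul_eq_mul_div, div_le_iff₀ hφ1]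
      nlinarith [mul_pos hδ hε]
    linarith
  have hxv : ∫ z, w z ∂((κ ^ (m + m')) x) = ∫ y, v y ∂((κ ^ m) x) := by
    have : (κ ^ (m + m')) x = ((κ ^ m') ∘ₖ (κ ^ m)) x := by rw [add_comm, Kernel.pow_add]
    rw [this, Kernel.integral_comp]
    exact integrable_of_abs_le hw hw1
  let D : Set X := {y | ε / 2 ≤ |v y|}
  have hDm : MeasurableSet D := measurableSet_le measurable_const hv.abs
  have hDφ : φ D < δ₀ := by
    have h1 : ε / 2 * φ.real D ≤ ∫ y, |v y| ∂φ :=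
      mul_meas_ge_le_integral_of_nonneg (Eventually.of_forall fun y => abs_nonneg _)
        (integrable_of_abs_le hv hv1).abs _
    have h2 : φ.real D < δ := by nlinarith [mul_pos hδ hε]
    refine lt_of_lt_of_le ?_ hδδ₀
    rwa [← ofReal_measureReal, ENNReal.ofReal_lt_ofReal_iff hδ]
  rw [hxv]
  have hind : Integrable (D.indicator (1 : X → ℝ)) ((κ ^ m) x) :=
    (integrable_const (1 : ℝ)).indicator hDm
  have hbd : ‖∫ y, v y ∂((κ ^ m) x)‖ ≤ ∫ y, (ε / 2 + D.indicator 1 y) ∂((κ ^ m) x) := by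
    refine norm_integral_le_of_norm_le ((integrable_const _).add hind)
      (Eventually.of_forall fun y => ?_)
    by_cases hy : y ∈ D
    · simp only [indicator_of_mem hy, Pi.one_apply]
      exact (hv1 y).trans (by linarith)
    · simp only [indicator_of_notMem hy, add_zero]
      exact (not_le.1 hy).le
  rw [integral_add (integrable_const _) (f := fun _ => ε / 2) hind,
    integral_indicator_one hDm] at hbd
  simp only [integral_const, probReal_univ, smul_eq_mul, one_mul] at hbd
  exact hbd.trans (by linarith [hD D hDm hDφ x])

/-! ### The Markov operator and the norm on signed measures -/

theorem vectorIntegral_toSignedMeasure (ν : Measure X) [IsFiniteMeasure ν] {f : X → ℝ}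
    (hf : Integrable f ν) :
    VectorMeasure.integral ν.toSignedMeasure f (ContinuousLinearMap.lsmul ℝ ℝ) = ∫ x, f x ∂ν := by
  have hv : ν.toSignedMeasure.variation = ν := Measure.variation_toSignedMeasure
  have hT := dominatedFinMeasAdditive_cbmApplyMeasure ν.toSignedMeasure
    (ContinuousLinearMap.lsmul ℝ ℝ)
  have hT' := hT
  rw [hv] at hT'
  rw [VectorMeasure.integral_eq_setToFun, integral_eq_setToFun,
    setToFun_congr_measure_of_integrable 1 ENNReal.one_ne_top (by rw [hv, one_smul]) _ hT' f
      (by rwa [hv])]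
  refine setToFun_congr_left' _ _ (fun s hs _ => ?_) f
  ext
  simp [transpose_eq_cbmApplyMeasure, weightedSMul_apply, hs]

theorem markovOperator_toSignedMeasure (κ : Kernel X X) [IsMarkovKernel κ] (ν : Measure X)
    [IsFiniteMeasure ν] :
    markovOperator κ ν.toSignedMeasure = (ν.bind κ).toSignedMeasure := by
  refine VectorMeasure.ext fun E hE => ?_
  rw [Measure.toSignedMeasure_apply_measurable hE, bind_real_apply κ ν hE]
  refine (signedImage_apply κ _ hE).trans (vectorIntegral_toSignedMeasure ν ?_)
  exact integrable_of_abs_le (measurable_kernel_real κ hE) (abs_kernel_real_le κ E)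

theorem markovOperator_pow_toSignedMeasure (κ : Kernel X X) [IsMarkovKernel κ] (ν : Measure X)
    [IsFiniteMeasure ν] (k : ℕ) :
    (markovOperator κ ^ k) ν.toSignedMeasure = (ν.bind ⇑(κ ^ k)).toSignedMeasure := by
  induction k with
  | zero =>
    have : ν.bind ⇑(κ ^ 0) = ν := Measure.id_comp
    rw [Measure.toSignedMeasure_congr this, pow_zero, one_apply_eq_self]
  | succ k ih =>
    have : ν.bind ⇑(κ ^ (k + 1)) = (ν.bind ⇑(κ ^ k)).bind κ := by
      rw [Measure.comp_assoc, pow_succ']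
      rfl
    rw [Measure.toSignedMeasure_congr this, pow_succ', mul_apply_eq_comp, ih,
      markovOperator_toSignedMeasure]

theorem norm_eq_add (σ : SignedMeasure X) :
    ‖σ‖ = σ.toJordanDecomposition.posPart.real univ + σ.toJordanDecomposition.negPart.real univ := by
  rw [norm_signedMeasure_eq, ← SignedMeasure.totalVariation_eq_variation,
    SignedMeasure.totalVariation, measureReal_add_apply]

/-- The Jordan parts live on complementary sets, and testing `σ` on each of these bounds one part by
`c`. -/
theorem norm_le_two_mul {σ : SignedMeasure X} {c : ℝ}
    (h : ∀ E, MeasurableSet E → |σ E| ≤ c) : ‖σ‖ ≤ 2 * c := by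
  obtain ⟨S, hS, hS0, hSc⟩ := σ.toJordanDecomposition.mutuallySingular
  have hσ : ∀ E, MeasurableSet E → σ E =
      σ.toJordanDecomposition.posPart.real E - σ.toJordanDecomposition.negPart.real E := by
    intro E hE
    conv_lhs => rw [← σ.toSignedMeasure_toJordanDecomposition]
    exact Measure.toSignedMeasure_sub_apply hE
  have h1 := h S hS
  have h2 := h Sᶜ hS.compl
  rw [hσ _ hS, measureReal_def, hS0] at h1
  rw [hσ _ hS.compl, measureReal_def (σ.toJordanDecomposition.negPart), hSc] at h2
  simp only [ENNReal.toReal_zero, zero_sub, sub_zero, abs_neg, abs_of_nonneg,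
    measureReal_nonneg] at h1 h2
  have h3 := measureReal_add_measureReal_compl (μ := σ.toJordanDecomposition.posPart) hS
  have h4 := measureReal_add_measureReal_compl (μ := σ.toJordanDecomposition.negPart) hS
  rw [measureReal_def, hS0, ENNReal.toReal_zero] at h3
  rw [measureReal_def _ Sᶜ, hSc, ENNReal.toReal_zero] at h4
  rw [norm_eq_add]
  linarith

/-- Evaluation of a signed measure at a set. -/
noncomputable def evalCLM (B : Set X) : SignedMeasure X →L[ℝ] ℝ :=
  LinearMap.mkContinuous
    { toFun := fun μ => μ B
      map_add' := fun _ _ => rfl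
      map_smul' := fun _ _ => rfl } 1 fun μ => by
    rw [one_mul, norm_signedMeasure_eq]
    exact (VectorMeasure.norm_measure_le_variation (measure_ne_top _ _)).trans
      (measureReal_mono (subset_univ B))

theorem evalCLM_apply (B : Set X) (μ : SignedMeasure X) : evalCLM B μ = μ B := rfl

/-! ### Conditional expectation onto a finite partition -/

section Quantize

/-- The part of the indicator function of `E` that `quantize ψ π` ignores. -/
noncomputable def quantizeDefect (ψ : Measure X) {ι : Type*} (π : X → ι) (E : Set X) (x : X) : ℝ :=
  E.indicator 1 x - (ψ.real (π ⁻¹' {π x}))⁻¹ * ψ.real (E ∩ π ⁻¹' {π x})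

theorem abs_quantizeDefect_le {ψ : Measure X} [IsFiniteMeasure ψ] {ι : Type*}
    {π : X → ι} {E : Set X} (x : X) : |quantizeDefect ψ π E x| ≤ 1 := by
  have h0 : 0 ≤ (ψ.real (π ⁻¹' {π x}))⁻¹ * ψ.real (E ∩ π ⁻¹' {π x}) := by positivity
  have h1 : (ψ.real (π ⁻¹' {π x}))⁻¹ * ψ.real (E ∩ π ⁻¹' {π x}) ≤ 1 :=
    inv_mul_le_one_of_le₀ (measureReal_mono inter_subset_right) measureReal_nonneg
  rw [quantizeDefect]
  by_cases hx : x ∈ E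
  · rw [indicator_of_mem hx, Pi.one_apply, abs_le]
    constructor <;> linarith
  · rw [indicator_of_notMem hx, abs_le]
    constructor <;> linarith

theorem setIntegral_quantizeDefect_fiber {ψ : Measure X} [IsFiniteMeasure ψ] {ι : Type*}
    {π : X → ι} {E : Set X} [MeasurableSpace ι] [MeasurableSingletonClass ι]
    (hπ : Measurable π) (hE : MeasurableSet E) (t : ι) :
    ∫ x in π ⁻¹' {t}, quantizeDefect ψ π E x ∂ψ = 0 := by
  have ht : MeasurableSet (π ⁻¹' {t}) := hπ (measurableSet_singleton t)
  have h1 : ∫ x in π ⁻¹' {t}, quantizeDefect ψ π E x ∂ψ =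
      ∫ x in π ⁻¹' {t},
        (E.indicator 1 x - (ψ.real (π ⁻¹' {t}))⁻¹ * ψ.real (E ∩ π ⁻¹' {t})) ∂ψ := by
    refine setIntegral_congr_fun ht fun x hx => ?_
    rw [mem_preimage, mem_singleton_iff] at hx
    rw [quantizeDefect, hx]
  rw [h1, integral_sub (f := E.indicator 1) ((integrable_const (1 : ℝ)).indicator hE)
      (integrable_const _),
    integral_indicator_one hE, integral_const, measureReal_restrict_apply hE,
    measureReal_restrict_apply_univ, smul_eq_mul]
  -- On a `ψ`-null fibre the inverse is `0` by convention, harmlessly, since `E` also has no mass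
  -- there.
  by_cases h0 : ψ.real (π ⁻¹' {t}) = 0
  · have : ψ.real (E ∩ π ⁻¹' {t}) = 0 :=
      le_antisymm ((measureReal_mono inter_subset_right).trans_eq h0) measureReal_nonneg
    simp [this]
  · rw [mul_inv_cancel_left₀ h0, sub_self]

variable {ι : Type*} [Fintype ι]

/-- The conditional expectation, with respect to `ψ`, onto the measures that have a density which
is constant on the fibres of `π`. -/
noncomputable def quantize (ψ : Measure X) [IsFiniteMeasure ψ] (π : X → ι) :
    SignedMeasure X →L[ℝ] SignedMeasure X :=
  ∑ t, (evalCLM (π ⁻¹' {t})).smulRight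
    ((ψ.real (π ⁻¹' {t}))⁻¹ • (ψ.restrict (π ⁻¹' {t})).toSignedMeasure)

theorem isCompactOperator_quantize (ψ : Measure X) [IsFiniteMeasure ψ] (π : X → ι) :
    IsCompactOperator (quantize ψ π) := by
  refine Submodule.sum_mem (compactOperator (RingHom.id ℝ) (SignedMeasure X) (SignedMeasure X))
    fun t _ => ?_
  exact ((isCompactOperator_id (E := ℝ)).comp_clm (evalCLM (π ⁻¹' {t}))).clm_comp
    (ContinuousLinearMap.toSpanSingleton ℝ
      ((ψ.real (π ⁻¹' {t}))⁻¹ • (ψ.restrict (π ⁻¹' {t})).toSignedMeasure))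

theorem quantize_apply (ψ : Measure X) [IsFiniteMeasure ψ] (π : X → ι) (μ : SignedMeasure X)
    {E : Set X} (hE : MeasurableSet E) : quantize ψ π μ E =
      ∑ t, μ (π ⁻¹' {t}) * ((ψ.real (π ⁻¹' {t}))⁻¹ * ψ.real (E ∩ π ⁻¹' {t})) := by
  rw [quantize, sum_apply, ← evalCLM_apply, map_sum]
  refine Finset.sum_congr rfl fun t _ => ?_
  rw [ContinuousLinearMap.smulRight_apply, map_smul, map_smul, evalCLM_apply, evalCLM_apply,
    Measure.toSignedMeasure_apply_measurable hE, measureReal_restrict_apply hE]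
  rfl

variable {ψ : Measure X} {π : X → ι} {E : Set X}
  [MeasurableSpace ι] [MeasurableSingletonClass ι]

theorem measurable_quantizeDefect (hπ : Measurable π) (hE : MeasurableSet E) :
    Measurable (quantizeDefect ψ π E) := by
  refine (measurable_const.indicator hE).sub ?_
  exact (measurable_of_finite
    fun t => (ψ.real (π ⁻¹' {t}))⁻¹ * ψ.real (E ∩ π ⁻¹' {t})).comp hπ

variable [IsFiniteMeasure ψ]

theorem setIntegral_quantizeDefect (hπ : Measurable π) (hE : MeasurableSet E) (T : Set ι) :
    ∫ x in π ⁻¹' T, quantizeDefect ψ π E x ∂ψ = 0 := by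
  classical
  have hT : π ⁻¹' T = ⋃ t ∈ T.toFinset, π ⁻¹' {t} := by
    ext x
    simp
  rw [hT, integral_biUnion_finset]
  · exact Finset.sum_eq_zero fun t _ => setIntegral_quantizeDefect_fiber hπ hE t
  · exact fun t _ => hπ (measurableSet_singleton t)
  · exact fun t _ t' _ h => Disjoint.preimage _ (by simpa using h)
  · exact fun t _ => (integrable_of_abs_le (measurable_quantizeDefect hπ hE)
      abs_quantizeDefect_le).integrableOn

theorem sub_quantize_apply (hπ : Measurable π) (ν : Measure X) [IsFiniteMeasure ν]
    (hE : MeasurableSet E) :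
    (ν.toSignedMeasure - quantize ψ π ν.toSignedMeasure) E = ∫ x, quantizeDefect ψ π E x ∂ν := by
  have hg : Measurable fun t : ι => (ψ.real (π ⁻¹' {t}))⁻¹ * ψ.real (E ∩ π ⁻¹' {t}) :=
    measurable_of_finite _
  have hi : Integrable (fun x => (ψ.real (π ⁻¹' {π x}))⁻¹ * ψ.real (E ∩ π ⁻¹' {π x})) ν :=
    (Integrable.of_finite (μ := ν.map π)
      (f := fun t : ι => (ψ.real (π ⁻¹' {t}))⁻¹ * ψ.real (E ∩ π ⁻¹' {t}))).comp_measurable hπ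
  simp only [quantizeDefect]
  rw [integral_sub (f := E.indicator 1) ((integrable_const (1 : ℝ)).indicator hE) hi,
    integral_indicator_one hE,
    ← integral_map hπ.aemeasurable hg.aestronglyMeasurable, integral_fintype .of_finite,
    sub_apply, quantize_apply ψ π _ hE, Measure.toSignedMeasure_apply_measurable hE]
  congr 1
  refine Finset.sum_congr rfl fun t _ => ?_
  rw [Measure.toSignedMeasure_apply_measurable (hπ (measurableSet_singleton t)),
    map_measureReal_apply hπ (measurableSet_singleton t), smul_eq_mul]

end Quantize

/-! ### Quasicompactness -/

theorem abs_integral_bind_le (K : Kernel X X) [IsMarkovKernel K] (ν : Measure X)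
    [IsFiniteMeasure ν] {w : X → ℝ} (hw : Measurable w) (hw1 : ∀ x, |w x| ≤ 1) {ε : ℝ}
    (h : ∀ x, |∫ z, w z ∂(K x)| ≤ ε) : |∫ z, w z ∂(ν.bind K)| ≤ ε * ν.real univ := by
  rw [Measure.comp_eq_comp_const_apply, Kernel.integral_comp (integrable_of_abs_le hw hw1),
    Kernel.const_apply]
  have h' : ∀ᵐ x ∂ν, ‖∫ z, w z ∂(K x)‖ ≤ ε := Eventually.of_forall h
  exact norm_integral_le_of_norm_le_const h'

/-- If all invariant charges are countably additive, then the chain is quasicompact. -/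
theorem ConditionStar.isQuasicompact {κ : Kernel X X} [IsMarkovKernel κ]
    (hκ : ConditionStar κ) : IsQuasicompact κ := by
  classical
  obtain ⟨k, ψ, 𝓑, hk, hψ, h𝓑, hB⟩ := hκ.exists_finset_abs_integral_le (ε := 1 / 4) (by norm_num)
  -- The fibres are the atoms of the algebra generated by `𝓑`, so each member of `𝓑` is a union of
  -- fibres and the defect integrates to zero over it.
  let π : X → (𝓑 → Prop) := fun x B => x ∈ B.1
  have hπ : Measurable π := measurable_pi_iff.2 fun B => measurableSet_setOfPred.1 (h𝓑 B.1 B.2)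
  have hpos : ∀ ν : Measure X, ∀ [IsFiniteMeasure ν],
      ‖(markovOperator κ ^ k - quantize ψ π ∘L markovOperator κ ^ k) ν.toSignedMeasure‖ ≤
        1 / 2 * ν.real univ := fun ν _ => by
    have h2 : ∀ E, MeasurableSet E →
        |((markovOperator κ ^ k - quantize ψ π ∘L markovOperator κ ^ k) ν.toSignedMeasure) E| ≤
          1 / 4 * ν.real univ := fun E hE => by
      rw [sub_apply, ContinuousLinearMap.comp_apply,
        markovOperator_pow_toSignedMeasure, sub_quantize_apply hπ _ hE]
      refine abs_integral_bind_le _ ν (measurable_quantizeDefect hπ hE) abs_quantizeDefect_le ?_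
      refine hB _ (measurable_quantizeDefect hπ hE) abs_quantizeDefect_le fun B hB' => ?_
      exact setIntegral_quantizeDefect hπ hE {t | t ⟨B, hB'⟩}
    exact (norm_le_two_mul h2).trans_eq (by ring)
  refine ⟨quantize ψ π ∘L markovOperator κ ^ k,
    (isCompactOperator_quantize ψ π).comp_clm (markovOperator κ ^ k), k, hk, ?_⟩
  refine (ContinuousLinearMap.opNorm_le_bound _ (M := 1 / 2) (by norm_num) fun μ => ?_).trans_lt
    (by norm_num)
  rw [norm_eq_add μ, mul_add]
  conv_lhs => rw [← μ.toSignedMeasure_toJordanDecomposition, JordanDecomposition.toSignedMeasure,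
    map_sub]
  exact (norm_sub_le _ _).trans (add_le_add (hpos _) (hpos _))

/-! ### The countably additive part of a charge -/

namespace Charge

theorem IsNonneg.mono {μ : Charge X} (hμ : μ.IsNonneg) {E F : Set X} (hE : MeasurableSet E)
    (hF : MeasurableSet F) (h : E ⊆ F) : μ E ≤ μ F := by
  have h1 := μ.union' E (F \ E) hE (hF.diff hE) disjoint_sdiff_right
  rw [union_sdiff_cancel h] at h1
  linarith [hμ _ (hF.diff hE)]

/-- A countably additive nonnegative charge is given by a finite measure. -/
theorem IsCountablyAdditive.exists_eq_ofMeasure {lam : Charge X} (hl : lam.IsCountablyAdditive)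
    (h0 : lam.IsNonneg) :
    ∃ (ν : Measure X) (_ : IsFiniteMeasure ν), lam = ofMeasure ν := by
  let σ : SignedMeasure X :=
    { measureOf' := lam.toFun
      empty' := lam.empty'
      not_measurable' := fun E hE => lam.not_measurable' E hE
      m_iUnion' := fun E hE hd => hl E hE hd }
  have hσ : 0 ≤[univ] σ := by
    rw [VectorMeasure.le_restrict_univ_iff_le]
    exact fun E hE => h0 E hE
  refine ⟨σ.toMeasureOfZeroLE univ .univ hσ, inferInstance, Charge.ext fun E hE => ?_⟩
  have := SignedMeasure.toMeasureOfZeroLE_toSignedMeasure σ hσ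
  exact (congrArg (fun τ : SignedMeasure X => τ E) this).symm

open Classical in
/-- The set function generating the countably additive part of `μ`. -/
noncomputable def preMeasure (μ : Charge X) (E : Set X) : ℝ≥0∞ :=
  if MeasurableSet E then ENNReal.ofReal (μ E) else ∞

theorem preMeasure_of_measurableSet (μ : Charge X) {E : Set X} (hE : MeasurableSet E) :
    μ.preMeasure E = ENNReal.ofReal (μ E) := if_pos hE

theorem preMeasure_empty (μ : Charge X) : μ.preMeasure ∅ = 0 := by
  rw [preMeasure_of_measurableSet μ .empty, μ.empty', ENNReal.ofReal_zero]

/-- A nonnegative charge dominates a largest measure. -/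
theorem IsNonneg.exists_greatest_measure {μ : Charge X} (hμ : μ.IsNonneg) :
    ∃ (ν : Measure X) (_ : IsFiniteMeasure ν), (∀ E, MeasurableSet E → ν.real E ≤ μ E) ∧
      ∀ ν' : Measure X, ∀ [IsFiniteMeasure ν'], (∀ E, MeasurableSet E → ν'.real E ≤ μ E) →
        ν' ≤ ν := by
  -- The infimum of `∑ μ (E i)` over countable measurable covers: finite additivity of `μ` makes
  -- measurable sets Carathéodory, and countable subadditivity puts every measure dominated by `μ`
  -- below it.
  let m := OuterMeasure.ofFunction μ.preMeasure μ.preMeasure_empty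
  have hm : ‹MeasurableSpace X› ≤ m.caratheodory := fun S hS => by
    refine OuterMeasure.ofFunction_caratheodory fun t => ?_
    by_cases ht : MeasurableSet t
    · rw [preMeasure_of_measurableSet μ ht, preMeasure_of_measurableSet μ (ht.inter hS),
        preMeasure_of_measurableSet μ (ht.diff hS), ← ENNReal.ofReal_add (hμ _ (ht.inter hS))
        (hμ _ (ht.diff hS)), ← μ.union' _ _ (ht.inter hS) (ht.diff hS)
        disjoint_sdiff_inter.symm, inter_union_sdiff]
    · rw [preMeasure, preMeasure, preMeasure, if_neg ht]
      exact le_top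
  have hle : ∀ E, MeasurableSet E → m.toMeasure hm E ≤ ENNReal.ofReal (μ E) := fun E hE => by
    rw [toMeasure_apply m hm hE, ← preMeasure_of_measurableSet μ hE]
    exact OuterMeasure.ofFunction_le E
  refine ⟨m.toMeasure hm, ⟨(hle univ .univ).trans_lt ENNReal.ofReal_lt_top⟩, fun E hE => ?_,
    fun ν' _ hν' => ?_⟩
  · exact ENNReal.toReal_le_of_le_ofReal (hμ E hE) (hle E hE)
  · refine Measure.le_iff.2 fun E hE => ?_
    rw [toMeasure_apply m hm hE]
    have : ν'.toOuterMeasure ≤ m := OuterMeasure.le_ofFunction.2 fun S => by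
      by_cases hS : MeasurableSet S
      · rw [preMeasure_of_measurableSet μ hS]
        change ν' S ≤ _
        rw [← ofReal_measureReal]
        exact ENNReal.ofReal_le_ofReal (hν' S hS)
      · rw [preMeasure, if_neg hS]
        exact le_top
    exact this E

end Charge

/-! ### Invariance of the purely finitely additive part -/

/-- If some invariant charge is not countably additive, then its purely finitely additive part is
invariant and nonzero. -/
theorem invariantPureCharges_nonempty {κ : Kernel X X} [IsMarkovKernel κ]
    (hκ : ¬ ConditionStar κ) : (invariantPureCharges κ).Nonempty := by
  obtain ⟨μ, ⟨⟨hμ, -⟩, hinv⟩, hca⟩ := not_subset.1 hκ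
  obtain ⟨ν, hν, hνμ, hmax⟩ := hμ.exists_greatest_measure
  have hdiff : (Charge.linComb 1 μ (-1) (Charge.ofMeasure ν)).IsNonneg := fun E hE => by
    rw [Charge.linComb_apply, Charge.ofMeasure_apply ν hE]
    linarith [hνμ E hE]
  have hbdd : ∀ E, ∃ M, ∀ x, |(κ x).real E| ≤ M := fun E => ⟨1, abs_kernel_real_le κ E⟩
  have hνint : ∀ E, MeasurableSet E →
      (Charge.ofMeasure ν).integral (fun x => (κ x).real E) = (ν.bind κ).real E := fun E hE => by
    rw [bind_real_apply κ ν hE]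
    exact (Charge.hasIntegral_ofMeasure ν (measurable_kernel_real κ hE) (hbdd E)).integral_eq
  have hμint : ∀ E, MeasurableSet E → μ.integral (fun x => (κ x).real E) = μ E := fun E hE => by
    rw [← chargeOperator_apply κ μ hE, hinv]
  have hνinv : ν.bind κ = ν := by
    have hle : ν.bind κ ≤ ν := hmax _ fun E hE => by
      have h1 := hdiff.integral_nonneg (measurable_kernel_real κ hE) (hbdd E)
        fun _ => measureReal_nonneg
      rw [Charge.integral_linComb _ _ _ _ (measurable_kernel_real κ hE) (hbdd E), hνint E hE,
        hμint E hE] at h1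
      linarith
    refine Measure.eq_of_le_of_measure_univ_eq hle ?_
    rw [Measure.bind_apply .univ κ.measurable.aemeasurable]
    simp
  set τ := Charge.linComb 1 μ (-1) (Charge.ofMeasure ν) with hτ
  have hτ0 : 0 < τ univ := by
    refine (hdiff univ .univ).lt_of_ne' fun h0 => hca ?_
    have : μ = Charge.ofMeasure ν := Charge.ext fun E hE => by
      have h1 := hdiff.mono hE .univ (subset_univ E)
      have h2 := hdiff E hE
      rw [h0] at h1
      have h3 := le_antisymm h1 h2
      rw [hτ, Charge.linComb_apply] at h3
      linarith
    rw [this]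
    exact Charge.ofMeasure_isCountablyAdditive ν
  have hτinv : ∀ E, MeasurableSet E → τ.integral (fun x => (κ x).real E) = τ E := fun E hE => by
    rw [hτ, Charge.integral_linComb _ _ _ _ (measurable_kernel_real κ hE) (hbdd E), hνint E hE,
      hμint E hE, hνinv, Charge.linComb_apply, Charge.ofMeasure_apply ν hE]
  -- A measure below `τ = μ - ν` could be added to `ν` while staying below `μ`, so maximality of `ν`
  -- makes it vanish.
  have hpure : ∀ ν' : Measure X, ∀ [IsFiniteMeasure ν'],
      (∀ E, MeasurableSet E → ν'.real E ≤ τ E) → ν' = 0 := fun ν' _ h => by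
    have h1 : ν' + ν ≤ ν := hmax _ fun E hE => by
      rw [measureReal_add_apply]
      have h2 := h E hE
      rw [hτ, Charge.linComb_apply, Charge.ofMeasure_apply ν hE] at h2
      linarith
    have h2 := h1 univ
    rw [Measure.add_apply, add_comm] at h2
    rw [← Measure.measure_univ_eq_zero]
    by_contra hne
    exact absurd h2 (not_le.2 (ENNReal.lt_add_right (measure_ne_top ν univ) hne))
  set c := (τ univ)⁻¹
  have hc : 0 < c := inv_pos.2 hτ0
  have happ : ∀ E, Charge.linComb c τ 0 τ E = c * τ E := fun E => by
    rw [Charge.linComb_apply, zero_mul, add_zero]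
  refine ⟨Charge.linComb c τ 0 τ, ⟨fun E hE => ?_, fun lam hl hl0 hle => ?_⟩, ⟨fun E hE => ?_, ?_⟩,
    Charge.ext fun E hE => ?_⟩
  · rw [happ]
    exact mul_nonneg hc.le (hdiff E hE)
  · obtain ⟨ν', hν', rfl⟩ := hl.exists_eq_ofMeasure hl0
    have h0 : (τ univ).toNNReal • ν' = 0 := hpure _ fun E hE => by
      have h1 := hle E hE
      rw [happ, Charge.ofMeasure_apply _ hE] at h1
      rw [measureReal_nnreal_smul_apply, Real.coe_toNNReal _ hτ0.le]
      calc τ univ * ν'.real E ≤ τ univ * (c * τ E) := by gcongr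
        _ = τ E := mul_inv_cancel_left₀ hτ0.ne' _
    intro E hE
    have h1 : ((τ univ).toNNReal • ν').real E = 0 := by rw [h0]; simp
    rw [measureReal_nnreal_smul_apply, Real.coe_toNNReal _ hτ0.le] at h1
    rw [Charge.ofMeasure_apply _ hE]
    exact (mul_eq_zero.1 h1).resolve_left hτ0.ne'
  · rw [happ]
    exact mul_nonneg hc.le (hdiff E hE)
  · rw [happ]
    exact inv_mul_cancel₀ hτ0.ne'
  · rw [chargeOperator_apply κ _ hE,
      Charge.integral_linComb _ _ _ _ (measurable_kernel_real κ hE) (hbdd E), hτinv E hE,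
      zero_mul, add_zero, happ]

end FAMarkov

theorem corollary4p3 {X : Type*} [MeasurableSpace X]
    (κ : ProbabilityTheory.Kernel X X) [ProbabilityTheory.IsMarkovKernel κ] :
    (FAMarkov.ConditionStar κ → FAMarkov.IsQuasicompact κ) ∧
    (¬ FAMarkov.IsQuasicompact κ → (FAMarkov.invariantPureCharges κ).Nonempty) :=
  ⟨fun h => h.isQuasicompact,
    fun h => FAMarkov.invariantPureCharges_nonempty fun hκ => h hκ.isQuasicompact⟩
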